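/- Let $\Gamma$ be a compact metric graph with finite vertex set $\mathcal V$ and finite non-empty edge set $\mathcal E$ (loops and multiple edges are allowed), each edge $e$ being identified with an interval $[0,\ell_e]$, $\ell_e>0$, and let $\ell_{\min}=\min_{e\in\mathcal E}\ell_e$. Let $\mathcal V_R\subset\mathcal V$. For $\sigma\ge 0$ let $H^{(\sigma)}$ be the operator $-\frac{d^2}{dx^2}$ in $L^2(\Gamma)=\bigoplus_{e\in\mathcal E}L^2([0,\ell_e])$ whose domain consists of the functions $f$ that belong to $W^{2,2}$ on every edge, are continuous at every vertex, and satisfy $\sum_{e}f'|_e(v)=\sigma f(v)$ for $v\in\mathcal V_R$ and $\sum_{e}f'|_e(v)=0$ for $v\in\mathcal V\setminus\mathcal V_R$, where the sums run over the edge ends at $v$ and derivatives are taken in the direction from the vertex into the edge. Let $\lambda_1(\sigma)\le\lambda_2(\sigma)\le\dots$ be the eigenvalues of $H^{(\sigma)}$, counted with multiplicity, and let $d_n(\sigma)=\lambda_n(\sigma)-\lambda_n(0)$. A star decomposition of $\Gamma$ is the choice of a point $u_e\in e$ (in the interior or at an end) on every edge $e$. The point $u_e$ cuts $e$ into two pieces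 (one possibly of length $0$), each attached to one end of $e$; for $v\in\mathcal V$, the star $\mathcal S_v$ consists of the pieces attached to $v$, and $|\mathcal S_v|$ is the sum of their lengths (for a loop at $v$ both pieces count). Then for every $n\ge1$ and every $\sigma>0$: 1. $d_n(\sigma)\ge 0$, and, if $\mathcal V_R\neq\emptyset$, for every star decomposition of $\Gamma$ $$d_n(\sigma)<\frac{2\sigma}{\min_{v\in\mathcal V_R}|\mathcal S_v|},$$ where the right-hand side is read as $+\infty$ if the minimum is $0$; 2. $$d_n(\sigma)<\frac{4\sigma}{\ell_{\min}}.$$ -/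

import Mathlib

open MeasureTheory Set

/-- A metric graph with vertex set `V` and edge set `E` (loops and multiple edges allowed): the
edge `e` is identified with the interval `[0, len e]`, whose endpoint `0` is glued to the vertex
`src e` and whose endpoint `len e` is glued to the vertex `tgt e`. -/
structure MetricGraph (V E : Type*) where
  src : E → V
  tgt : E → V
  len : E → ℝ
  len_pos : ∀ e, 0 < len e

/-- `IsSobolevTwo ℓ u u' u''`: on `[0, ℓ]`, `u` is the `C¹` representative of an element of the
Sobolev space `W^{2,2}(0, ℓ)`, with derivative `u'` and weak second derivative `u''`; that is, `u`
and `u'` are absolutely continuous on `[0, ℓ]` with densities `u'` and `u''`, and `u'' ∈ L²`. -/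
structure IsSobolevTwo (ℓ : ℝ) (u u' u'' : ℝ → ℂ) : Prop where
  memLp : MemLp u'' 2 (volume.restrict (Icc 0 ℓ))
  eq_integral : ∀ x ∈ Icc (0 : ℝ) ℓ, u x = u 0 + ∫ t in (0 : ℝ)..x, u' t
  deriv_eq_integral : ∀ x ∈ Icc (0 : ℝ) ℓ, u' x = u' 0 + ∫ t in (0 : ℝ)..x, u'' t

namespace IsSobolevTwo

lemma intervalIntegrable_of_integrableOn {ℓ x : ℝ} {w : ℝ → ℂ} (hw : IntegrableOn w (Icc 0 ℓ))
    (hx : x ∈ Icc (0 : ℝ) ℓ) : IntervalIntegrable w volume 0 x := by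
  rw [intervalIntegrable_iff_integrableOn_Icc_of_le hx.1]
  exact hw.mono_set (Icc_subset_Icc_right hx.2)

lemma continuousOn_of_eq_integral {ℓ : ℝ} (hℓ : 0 < ℓ) {w W : ℝ → ℂ}
    (hw : IntegrableOn w (Icc 0 ℓ))
    (hW : ∀ x ∈ Icc (0 : ℝ) ℓ, W x = W 0 + ∫ t in (0 : ℝ)..x, w t) :
    ContinuousOn W (Icc 0 ℓ) := by
  have h := intervalIntegral.continuousOn_primitive_interval (μ := volume) (f := w) (a := 0)
    (b := ℓ) (by rwa [uIcc_of_le hℓ.le])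
  rw [uIcc_of_le hℓ.le] at h
  exact (continuousOn_const.add h).congr hW

/-- A density of an absolutely continuous function that vanishes a.e. itself vanishes a.e. -/
lemma density_ae_eq_zero {ℓ : ℝ} (hℓ : 0 < ℓ) {w W : ℝ → ℂ} (hw : IntegrableOn w (Icc 0 ℓ))
    (hW : ∀ x ∈ Icc (0 : ℝ) ℓ, W x = W 0 + ∫ t in (0 : ℝ)..x, w t)
    (h0 : W =ᵐ[volume.restrict (Icc 0 ℓ)] 0) : w =ᵐ[volume.restrict (Icc 0 ℓ)] 0 := by
  have hEq : EqOn W 0 (Icc 0 ℓ) := Measure.eqOn_Icc_of_ae_eq volume hℓ.ne h0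
    (continuousOn_of_eq_integral hℓ hw hW) continuousOn_const
  have hint : ∀ x ∈ Icc (0 : ℝ) ℓ, ∫ t in (0 : ℝ)..x, w t = 0 := fun x hx => by
    have h1 := hW x hx
    rw [hEq hx, hEq (left_mem_Icc.2 hℓ.le)] at h1
    simpa using h1.symm
  have hder := (intervalIntegrable_of_integrableOn hw
    (right_mem_Icc.2 hℓ.le)).ae_hasDerivAt_integral
  rw [← restrict_Ioo_eq_restrict_Icc]
  refine (ae_restrict_iff' measurableSet_Ioo).2 ?_
  filter_upwards [hder] with x hx hxI
  rw [uIcc_of_le hℓ.le] at hx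
  have h2 := hx (Ioo_subset_Icc_self hxI) 0 (left_mem_Icc.2 hℓ.le)
  have h3 : HasDerivAt (fun x => ∫ t in (0 : ℝ)..x, w t) 0 x :=
    (hasDerivAt_const x (0 : ℂ)).congr_of_eventuallyEq (by
      filter_upwards [Ioo_mem_nhds hxI.1 hxI.2] with y hy
      exact hint y (Ioo_subset_Icc_self hy))
  exact h2.unique h3

variable {ℓ : ℝ} {u u' u'' v v' v'' : ℝ → ℂ}

lemma integrableOn_snd (h : IsSobolevTwo ℓ u u' u'') : IntegrableOn u'' (Icc 0 ℓ) :=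
  h.memLp.integrable (by norm_num)

lemma integrableOn_fst (hℓ : 0 < ℓ) (h : IsSobolevTwo ℓ u u' u'') : IntegrableOn u' (Icc 0 ℓ) :=
  (continuousOn_of_eq_integral hℓ h.integrableOn_snd h.deriv_eq_integral).integrableOn_Icc

lemma snd_ae_eq_zero (hℓ : 0 < ℓ) (h : IsSobolevTwo ℓ u u' u'')
    (h0 : u =ᵐ[volume.restrict (Icc 0 ℓ)] 0) : u'' =ᵐ[volume.restrict (Icc 0 ℓ)] 0 :=
  density_ae_eq_zero hℓ h.integrableOn_snd h.deriv_eq_integral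
    (density_ae_eq_zero hℓ (h.integrableOn_fst hℓ) h.eq_integral h0)

lemma zero : IsSobolevTwo ℓ 0 0 0 := ⟨MemLp.zero, by simp, by simp⟩

lemma add (hℓ : 0 < ℓ) (hu : IsSobolevTwo ℓ u u' u'') (hv : IsSobolevTwo ℓ v v' v'') :
    IsSobolevTwo ℓ (u + v) (u' + v') (u'' + v'') where
  memLp := hu.memLp.add hv.memLp
  eq_integral x hx := by
    simp only [Pi.add_apply]
    rw [intervalIntegral.integral_add
      (intervalIntegrable_of_integrableOn (hu.integrableOn_fst hℓ) hx)
      (intervalIntegrable_of_integrableOn (hv.integrableOn_fst hℓ) hx),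
      hu.eq_integral x hx, hv.eq_integral x hx]
    ring
  deriv_eq_integral x hx := by
    simp only [Pi.add_apply]
    rw [intervalIntegral.integral_add
      (intervalIntegrable_of_integrableOn hu.integrableOn_snd hx)
      (intervalIntegrable_of_integrableOn hv.integrableOn_snd hx),
      hu.deriv_eq_integral x hx, hv.deriv_eq_integral x hx]
    ring

lemma smul (c : ℂ) (hu : IsSobolevTwo ℓ u u' u'') :
    IsSobolevTwo ℓ (c • u) (c • u') (c • u'') where
  memLp := hu.memLp.const_smul c
  eq_integral x hx := by
    simp only [Pi.smul_apply]
    rw [intervalIntegral.integral_smul, hu.eq_integral x hx, smul_add]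
  deriv_eq_integral x hx := by
    simp only [Pi.smul_apply]
    rw [intervalIntegral.integral_smul, hu.deriv_eq_integral x hx, smul_add]

end IsSobolevTwo

noncomputable section

namespace MetricGraph

variable {V E : Type*} [DecidableEq V] [Fintype E]

/-- The Hilbert space `L²(Γ) = ⨁ₑ L²([0, ℓₑ])`. -/
abbrev L2 (G : MetricGraph V E) : Type _ :=
  PiLp 2 (fun e => Lp ℂ 2 (volume.restrict (Icc (0 : ℝ) (G.len e))))

/-- The sum at the vertex `v` of the derivatives, taken in the direction pointing from `v` into
the edges, of a function on the graph whose derivative on the edge `e` (with respect to the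
coordinate `x ∈ [0, ℓₑ]`) is `u' e`. A loop at `v` contributes with both of its ends. -/
def outwardFlux (G : MetricGraph V E) (u' : E → ℝ → ℂ) (v : V) : ℂ :=
  (∑ e with G.src e = v, u' e 0) - ∑ e with G.tgt e = v, u' e (G.len e)

/-- The graph of the operator `H^(σ)`, as a relation between `f` and `h` in `L²(Γ)`: `f` is
`W^{2,2}` on each edge and continuous at all vertices (with vertex values `φ`), its outward
derivatives sum to `σ φ(v)` at the vertices `v ∈ R` and to `0` at all others, and `h = -f''` on
each edge. -/
def robinGraph (G : MetricGraph V E) (R : Finset V) (σ : ℝ) : Submodule ℂ (G.L2 × G.L2) where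
  carrier := {p | ∃ (u u' u'' : E → ℝ → ℂ) (φ : V → ℂ),
    (∀ e, IsSobolevTwo (G.len e) (u e) (u' e) (u'' e)) ∧
    (∀ e, p.1 e =ᵐ[volume.restrict (Icc (0 : ℝ) (G.len e))] u e) ∧
    (∀ e, p.2 e =ᵐ[volume.restrict (Icc (0 : ℝ) (G.len e))] -u'' e) ∧
    (∀ e, u e 0 = φ (G.src e) ∧ u e (G.len e) = φ (G.tgt e)) ∧
    (∀ v, G.outwardFlux u' v = if v ∈ R then (σ : ℂ) * φ v else 0)}
  zero_mem' := by
    refine ⟨0, 0, 0, 0, fun e => IsSobolevTwo.zero, fun e => ?_, fun e => ?_, by simp,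
      by simp [outwardFlux]⟩
    · exact Lp.coeFn_zero _ _ _
    · simpa using Lp.coeFn_zero ℂ 2 (volume.restrict (Icc (0 : ℝ) (G.len e)))
  add_mem' := by
    rintro p q ⟨u, u', u'', φ, h1, h2, h3, h4, h5⟩ ⟨w, w', w'', ψ, k1, k2, k3, k4, k5⟩
    refine ⟨u + w, u' + w', u'' + w'', φ + ψ, fun e => (h1 e).add (G.len_pos e) (k1 e),
      fun e => ?_, fun e => ?_, fun e => ?_, fun v => ?_⟩
    · exact (Lp.coeFn_add (p.1 e) (q.1 e)).trans ((h2 e).add (k2 e))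
    · refine (Lp.coeFn_add (p.2 e) (q.2 e)).trans (((h3 e).add (k3 e)).trans ?_)
      rw [Pi.add_apply, neg_add]
    · simp [h4 e, k4 e]
    · have : G.outwardFlux (u' + w') v = G.outwardFlux u' v + G.outwardFlux w' v := by
        simp only [outwardFlux, Pi.add_apply, Finset.sum_add_distrib]
        ring
      rw [this, h5, k5]
      split_ifs <;> simp [mul_add]
  smul_mem' := by
    rintro c p ⟨u, u', u'', φ, h1, h2, h3, h4, h5⟩
    refine ⟨c • u, c • u', c • u'', c • φ, fun e => (h1 e).smul c,
      fun e => ?_, fun e => ?_, fun e => ?_, fun v => ?_⟩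
    · exact (Lp.coeFn_smul c (p.1 e)).trans ((h2 e).const_smul c)
    · refine (Lp.coeFn_smul c (p.2 e)).trans (((h3 e).const_smul c).trans ?_)
      rw [Pi.smul_apply, smul_neg]
    · simp [h4 e]
    · have : G.outwardFlux (c • u') v = c * G.outwardFlux u' v := by
        simp only [outwardFlux, Pi.smul_apply, smul_eq_mul, Finset.mul_sum, mul_sub]
      rw [this, h5]
      split_ifs
      · simp only [Pi.smul_apply, smul_eq_mul]
        ring
      · simp

/-- The operator `H^(σ)` on `L²(Γ)`: the Laplacian `-d²/dx²` with the Robin condition of parameter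
`σ` at the vertices in `R` and the Neumann–Kirchhoff condition at all other vertices. -/
def robinLaplacian (G : MetricGraph V E) (R : Finset V) (σ : ℝ) : G.L2 →ₗ.[ℂ] G.L2 :=
  (G.robinGraph R σ).toLinearPMap

/-- The relation `robinGraph` is single-valued, so it is indeed the graph of `robinLaplacian`. -/
lemma robinLaplacian_graph (G : MetricGraph V E) (R : Finset V) (σ : ℝ) :
    (G.robinLaplacian R σ).graph = G.robinGraph R σ := by
  refine Submodule.toLinearPMap_graph_eq _ ?_
  rintro p ⟨u, u', u'', φ, h1, h2, h3, -, -⟩ hp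
  ext e : 1
  have h0 : u e =ᵐ[volume.restrict (Icc (0 : ℝ) (G.len e))] 0 := by
    refine (h2 e).symm.trans ?_
    rw [hp]
    exact Lp.coeFn_zero _ _ _
  have h := (h1 e).snd_ae_eq_zero (G.len_pos e) h0
  refine Lp.ext ((h3 e).trans ?_)
  refine Filter.EventuallyEq.trans ?_ (Lp.coeFn_zero _ _ _).symm
  filter_upwards [h] with x hx
  simp [hx]

/-- The eigenspace `{f ∈ dom H^(σ) | H^(σ) f = μ f}`. -/
def robinEigenspace (G : MetricGraph V E) (R : Finset V) (σ μ : ℝ) : Submodule ℂ G.L2 :=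
  (G.robinLaplacian R σ).graph.comap (LinearMap.id.prod ((μ : ℂ) • LinearMap.id))

/-- The `n`-th eigenvalue `λₙ(σ)` (`n = 1, 2, …`) of `H^(σ)`, in increasing order and counted with
multiplicity: the least `Λ` such that the eigenspaces of the eigenvalues `≤ Λ` together span a
space of dimension at least `n`. -/
def robinEigenvalue (G : MetricGraph V E) (R : Finset V) (σ : ℝ) (n : ℕ) : ℝ :=
  sInf {Λ : ℝ | (n : Cardinal) ≤
    Module.rank ℂ (⨆ μ ∈ Iic Λ, G.robinEigenspace R σ μ : Submodule ℂ G.L2)}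

/-- The Robin–Neumann gap `dₙ(σ) = λₙ(σ) - λₙ(0)`. -/
def robinNeumannGap (G : MetricGraph V E) (R : Finset V) (n : ℕ) (σ : ℝ) : ℝ :=
  G.robinEigenvalue R σ n - G.robinEigenvalue R 0 n

/-- A star decomposition: on every edge `e` an auxiliary point, in the interior of the edge or at
one of its ends, at the coordinate `cut e ∈ [0, ℓₑ]`. It splits the edge into a part of length
`cut e` belonging to the star of `src e` and a part of length `ℓₑ - cut e` belonging to the star
of `tgt e`. -/
structure StarDecomposition (G : MetricGraph V E) where
  cut : E → ℝ
  cut_mem : ∀ e, cut e ∈ Icc (0 : ℝ) (G.len e)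

/-- The total length `|S_v|` of the star around the vertex `v`. -/
def StarDecomposition.starLength {G : MetricGraph V E} (S : G.StarDecomposition) (v : V) : ℝ :=
  (∑ e with G.src e = v, S.cut e) + ∑ e with G.tgt e = v, (G.len e - S.cut e)

/-- The length `ℓ_min` of the shortest edge. -/
def minLength (G : MetricGraph V E) [Nonempty E] : ℝ :=
  Finset.univ.inf' Finset.univ_nonempty G.len

end MetricGraph

end

/-! Passing to quadratic forms on $H^1(\Gamma)$, the numbers $\lambda_n(\sigma)+1$ are the
eigenvalues of the pencil $\|w'\|^2+\|w\|^2+\sigma\sum_{v\in R}|w(v)|^2$ against $\|w\|^2$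
(`map_weakEigenspace`, `robinEigenvalue_eq`). The shift by 1 makes the form coercive, and
$H^1(\Gamma)\to L^2(\Gamma)$ is compact, so a variational principle holds
(`IsDiscrete.eigenvalue_le`). The form grows with $\sigma$, hence so do its eigenvalues, which gives
$d_n\ge 0$.

For the upper bound, $\lambda_n$ is Lipschitz on bounded intervals of $\sigma$, and first-order
perturbation bounds its right slope at $t$ by the largest value of $\sum_R|w(v)|^2/\|w\|^2$ on the
eigenspace (`eventually_eigenvalue_perturb_le`). No differentiable eigenvalue branches are needed: a
comparison principle integrates the slope bound (`eigenvalue_perturb_le_add`).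

The slope is controlled by a pointwise identity. If $-u''=\mu u$ on an edge, then $|u'|^2+\mu|u|^2$
is constant there (`energy_eq`). Its integral is therefore its value at one end times $a$ plus its
value at the other end times $\ell_e-a$, for any cut $a$, and dropping $|u'|^2$ at the ends leaves
$\mu$ times the vertex values (`edge_energy_ge`). Summing over the edges and regrouping by stars,
with $m$ the least star length, gives $\mu
m\sum_R|w(v)|^2\le\|w'\|^2+\mu\|w\|^2=2\mu\|w\|^2-t\sum_R|w(v)|^2$. So the slope is at most
$2/(m+t/\mu)$ when $\mu>0$ (`trace_bound`). The bound $2/m$ is improved uniformly on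
$[\sigma/2,\sigma]$, and this makes the final inequality strict. Cutting every edge at its midpoint
gives stars of length at least $\ell_{\min}/2$, hence the second bound. -/

noncomputable section

/-! ### Pencils of quadratic forms: spectral subspaces and their dimensions. -/

namespace FormPencil

open Module End
open scoped InnerProductSpace

variable {W K H : Type*} [NormedAddCommGroup W] [InnerProductSpace ℂ W]
  [NormedAddCommGroup K] [InnerProductSpace ℂ K]
  [NormedAddCommGroup H] [InnerProductSpace ℂ H]

/-- The eigenspace at `κ` of the pencil of forms `⟪L w, L z⟫`, `⟪J w, J z⟫`: the vectors `w` with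
`⟪L w, L z⟫ = κ ⟪J w, J z⟫` for all `z`. -/
def eigenspace (L : W →L[ℂ] K) (J : W →L[ℂ] H) (κ : ℝ) : Submodule ℂ W where
  carrier := {w | ∀ z, ⟪L w, L z⟫_ℂ = κ * ⟪J w, J z⟫_ℂ}
  zero_mem' := by simp
  add_mem' {a b} ha hb z := by
    simp only [map_add, inner_add_left, ha z, hb z, mul_add]
  smul_mem' c w hw z := by
    simp only [map_smul, inner_smul_left, hw z]
    ring

/-- The span of the eigenspaces of all the eigenvalues `≤ Λ`. -/
def spectralSubspace (L : W →L[ℂ] K) (J : W →L[ℂ] H) (Λ : ℝ) : Submodule ℂ W :=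
  ⨆ κ ∈ Iic Λ, eigenspace L J κ

/-- The `n`-th eigenvalue of the pencil, counted with multiplicity. -/
def eigenvalue (L : W →L[ℂ] K) (J : W →L[ℂ] H) (n : ℕ) : ℝ :=
  sInf {Λ : ℝ | (n : Cardinal) ≤ Module.rank ℂ (spectralSubspace L J Λ)}

variable {L : W →L[ℂ] K} {J : W →L[ℂ] H}

lemma eigenspace_le_spectralSubspace {κ Λ : ℝ} (h : κ ≤ Λ) :
    eigenspace L J κ ≤ spectralSubspace L J Λ :=
  le_iSup₂_of_le κ h le_rfl

lemma spectralSubspace_mono : Monotone (spectralSubspace L J) := fun _ _ h =>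
  iSup₂_le fun _ hκ => eigenspace_le_spectralSubspace (le_trans hκ h)

lemma inner_self_eq_ofReal {F : Type*} [NormedAddCommGroup F] [InnerProductSpace ℂ F] (x : F) :
    ⟪x, x⟫_ℂ = ((‖x‖ ^ 2 : ℝ) : ℂ) := by
  rw [inner_self_eq_norm_sq_to_K, Complex.ofReal_pow]
  rfl

lemma norm_sq_of_mem_eigenspace {κ : ℝ} {w : W} (hw : w ∈ eigenspace L J κ) :
    ‖L w‖ ^ 2 = κ * ‖J w‖ ^ 2 := by
  have h := hw w
  rw [inner_self_eq_ofReal, inner_self_eq_ofReal] at h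
  exact_mod_cast h

/-- The form of `L` is Hermitian, so evaluating it at $(w,w')$ through either eigenvector gives
$(\kappa-\kappa')\langle Jw,Jw'\rangle=0$. -/
lemma inner_eq_zero_of_ne {κ κ' : ℝ} (h : κ ≠ κ') {w w' : W} (hw : w ∈ eigenspace L J κ)
    (hw' : w' ∈ eigenspace L J κ') : ⟪J w, J w'⟫_ℂ = 0 := by
  have h1 := hw w'
  have h2 := hw' w
  rw [← inner_conj_symm, ← inner_conj_symm (J w'), h1] at h2
  simp only [map_mul, Complex.conj_ofReal, inner_conj_symm] at h2
  have h3 := congrArg (starRingEnd ℂ) h2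
  simp only [map_mul, Complex.conj_ofReal, inner_conj_symm] at h3
  have h4 : ((κ : ℂ) - κ') * ⟪J w, J w'⟫_ℂ = 0 := by linear_combination h3
  rcases mul_eq_zero.1 h4 with h5 | h5
  · exact absurd (by exact_mod_cast sub_eq_zero.1 h5) h
  · exact h5

/-- On the spectral subspace at `Λ` the form of `L` is at most `Λ` times the form of `J`. -/
lemma norm_sq_le_of_mem_spectralSubspace {Λ : ℝ} {w : W} (hw : w ∈ spectralSubspace L J Λ) :
    ‖L w‖ ^ 2 ≤ Λ * ‖J w‖ ^ 2 := by
  rw [spectralSubspace, iSup_subtype', Submodule.mem_iSup_iff_exists_finsupp] at hw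
  obtain ⟨f, hf, rfl⟩ := hw
  have key : ∀ i ∈ f.support, ⟪J (f i), J (f.sum fun _ x => x)⟫_ℂ = (‖J (f i)‖ ^ 2 : ℝ) := by
    intro i hi
    rw [Finsupp.sum, map_sum, inner_sum, Finset.sum_eq_single i]
    · rw [inner_self_eq_ofReal]
    · intro j _ hj
      exact inner_eq_zero_of_ne (fun h => hj (Subtype.ext h.symm)) (hf i) (hf j)
    · exact fun h => absurd hi h
  have hJ : ‖J (f.sum fun _ x => x)‖ ^ 2 = ∑ i ∈ f.support, ‖J (f i)‖ ^ 2 := by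
    have : ((‖J (f.sum fun _ x => x)‖ ^ 2 : ℝ) : ℂ) =
        ((∑ i ∈ f.support, ‖J (f i)‖ ^ 2 : ℝ) : ℂ) := by
      rw [← inner_self_eq_ofReal, Complex.ofReal_sum]
      nth_rewrite 1 [Finsupp.sum]
      rw [map_sum, sum_inner]
      exact Finset.sum_congr rfl fun i hi => key i hi
    exact_mod_cast this
  have hL : ‖L (f.sum fun _ x => x)‖ ^ 2 = ∑ i ∈ f.support, (i : ℝ) * ‖J (f i)‖ ^ 2 := by
    have : ((‖L (f.sum fun _ x => x)‖ ^ 2 : ℝ) : ℂ)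
        = ((∑ i ∈ f.support, (i : ℝ) * ‖J (f i)‖ ^ 2 : ℝ) : ℂ) := by
      rw [← inner_self_eq_ofReal, Complex.ofReal_sum]
      nth_rewrite 1 [Finsupp.sum]
      rw [map_sum, sum_inner]
      exact Finset.sum_congr rfl fun i hi => by rw [hf i, key i hi, Complex.ofReal_mul]
    exact_mod_cast this
  rw [hJ, hL, Finset.mul_sum]
  exact Finset.sum_le_sum fun i _ => mul_le_mul_of_nonneg_right i.2 (sq_nonneg _)

/-- A vector orthogonal to the eigenvectors of the eigenvalues `≤ Λ` satisfies the reversed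
inequality; the case where the form of `L` is the inner product. -/
lemma norm_sq_ge_of_orthogonal_id [CompleteSpace W] [CompleteSpace H] (hJ : IsCompactOperator J)
    {Λ : ℝ} {x : W}
    (hx : ∀ κ ≤ Λ, ∀ u ∈ eigenspace (ContinuousLinearMap.id ℂ W) J κ, ⟪u, x⟫_ℂ = 0) :
    Λ * ‖J x‖ ^ 2 ≤ ‖x‖ ^ 2 := by
  rcases le_or_gt Λ 0 with hΛ | hΛ
  · exact (mul_nonpos_of_nonpos_of_nonneg hΛ (sq_nonneg _)).trans (sq_nonneg _)
  -- For $\kappa\ne 0$, pencil eigenvectors at $\kappa$ are eigenvectors of the compact self-adjoint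
  -- $J^*J$ at $1/\kappa$, so eigenvalues $\le\Lambda$ turn into eigenvalues $\ge 1/\Lambda$.
  set A : W →L[ℂ] W := (ContinuousLinearMap.adjoint J) ∘L J with hA
  have hAi : ∀ y z, ⟪A y, z⟫_ℂ = ⟪J y, J z⟫_ℂ := fun y z => by
    simp [hA, ContinuousLinearMap.adjoint_inner_left]
  have hAc : IsCompactOperator A :=
    hJ.clm_comp (ContinuousLinearMap.adjoint J)
  have hAs : (A : W →ₗ[ℂ] W).IsSymmetric := fun y z => by
    have h1 := hAi y z
    have h2 := hAi z y
    rw [ContinuousLinearMap.coe_coe, h1, ← inner_conj_symm y, h2, inner_conj_symm]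
  set U : Submodule ℂ W := spectralSubspace (ContinuousLinearMap.id ℂ W) J Λ with hU
  have hE : ∀ κ ≤ Λ, ∀ u ∈ eigenspace (ContinuousLinearMap.id ℂ W) J κ, u = (κ : ℂ) • A u := by
    intro κ _ u hu
    refine ext_inner_right ℂ fun z => ?_
    rw [inner_smul_left, hAi]
    simpa using hu z
  have hinv : ∀ y ∈ Uᗮ, A y ∈ Uᗮ := by
    intro y hy
    have : U ≤ (ℂ ∙ (A y))ᗮ := by
      refine iSup₂_le fun κ hκ u hu => ?_
      rw [Submodule.mem_orthogonal_singleton_iff_inner_left]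
      have h1 : ⟪A u, y⟫_ℂ = ⟪u, A y⟫_ℂ := hAs u y
      rcases eq_or_ne κ 0 with h0 | h0
      · have := hE κ hκ u hu
        rw [h0] at this
        simp only [Complex.ofReal_zero, zero_smul] at this
        rw [this, inner_zero_left]
      · have h2 : ⟪u, y⟫_ℂ = 0 := hy u (eigenspace_le_spectralSubspace hκ hu)
        rw [hE κ hκ u hu, inner_smul_left] at h2
        rw [← h1]
        exact (mul_eq_zero.1 h2).resolve_left (by simpa using h0)
    intro u hu
    exact (Submodule.mem_orthogonal_singleton_iff_inner_left).1 (this hu)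
  set S : Uᗮ →L[ℂ] Uᗮ := A.restrict hinv with hS
  have hSc : IsCompactOperator S := IsCompactOperator.restrict' (f := (A : W →ₗ[ℂ] W)) hAc hinv
  have hSs : (S : Uᗮ →ₗ[ℂ] Uᗮ).IsSymmetric := hAs.restrict_invariant hinv
  -- The restriction of $J^*J$ to $U^\perp$ has no eigenvalue $r\ge 1/\Lambda$: its eigenvector
  -- would be a pencil eigenvector at $1/r\le\Lambda$ and so lie in $U$. For a compact self-adjoint
  -- operator this bounds the spectral radius, which is the norm.
  have hSn : ‖S‖ ≤ Λ⁻¹ := by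
    have h1 : spectralRadius ℂ S ≤ ENNReal.ofReal Λ⁻¹ := by
      refine iSup₂_le fun c hc => ?_
      rcases eq_or_ne c 0 with h0 | h0
      · simp [h0]
      obtain ⟨m, hm⟩ := ((hSc.hasEigenvalue_iff_mem_spectrum h0).2 hc).exists_hasEigenvector
      have hm1 : A (m : W) = c • (m : W) := by
        have := congrArg (Subtype.val) hm.apply_eq_smul
        simpa [hS] using this
      have hm0 : (m : W) ≠ 0 := fun h => hm.2 (Subtype.ext h)
      have hcr : c = ((‖J (m : W)‖ ^ 2 / ‖(m : W)‖ ^ 2 : ℝ) : ℂ) := by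
        have h2 := hAi m m
        have h3 : (starRingEnd ℂ) c = c := hSs.conj_eigenvalue_eq_self
          ((hSc.hasEigenvalue_iff_mem_spectrum h0).2 hc)
        have h4 : ((‖(m : W)‖ ^ 2 : ℝ) : ℂ) ≠ 0 := by simpa using hm0
        rw [hm1, inner_smul_left, h3, inner_self_eq_ofReal, inner_self_eq_ofReal] at h2
        rw [Complex.ofReal_div, eq_div_iff h4]
        exact h2
      set r : ℝ := ‖J (m : W)‖ ^ 2 / ‖(m : W)‖ ^ 2 with hr
      have hr0 : 0 ≤ r := by positivity
      have hr1 : r < Λ⁻¹ := by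
        by_contra hcon
        push Not at hcon
        have hrpos : 0 < r := lt_of_lt_of_le (inv_pos.2 hΛ) hcon
        have hmem : (m : W) ∈ U := by
          refine eigenspace_le_spectralSubspace (κ := r⁻¹) (inv_le_of_inv_le₀ hΛ hcon) fun z => ?_
          rw [← hAi, hm1, hcr, inner_smul_left]
          simp only [ContinuousLinearMap.coe_id', id_eq, Complex.conj_ofReal]
          rw [← mul_assoc, ← Complex.ofReal_mul, inv_mul_cancel₀ hrpos.ne']
          simp
        exact hm0 (inner_self_eq_zero.1 (m.2 _ hmem))
      rw [hcr, ← ENNReal.ofReal_coe_nnreal]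
      refine ENNReal.ofReal_le_ofReal ?_
      rw [coe_nnnorm, Complex.norm_real, Real.norm_of_nonneg hr0]
      exact hr1.le
    rw [ContinuousLinearMap.spectralRadius_eq_nnnorm S hSs.isSelfAdjoint,
      ← ENNReal.ofReal_coe_nnreal,
      ENNReal.ofReal_le_ofReal_iff (inv_nonneg.2 hΛ.le)] at h1
    simpa using h1
  have hxU : x ∈ Uᗮ := by
    have : U ≤ (ℂ ∙ x)ᗮ := iSup₂_le fun κ hκ u hu => by
      rw [Submodule.mem_orthogonal_singleton_iff_inner_left]
      exact hx κ hκ u hu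
    exact fun u hu => (Submodule.mem_orthogonal_singleton_iff_inner_left).1 (this hu)
  have h1 : ‖A x‖ ≤ Λ⁻¹ * ‖x‖ := (S.le_of_opNorm_le hSn ⟨x, hxU⟩)
  have h2 : ‖J x‖ ^ 2 ≤ ‖A x‖ * ‖x‖ := by
    have h3 := norm_inner_le_norm (𝕜 := ℂ) (A x) x
    rw [hAi, inner_self_eq_norm_sq_to_K] at h3
    simpa using h3
  have h4 : ‖J x‖ ^ 2 ≤ Λ⁻¹ * ‖x‖ ^ 2 :=
    h2.trans (by nlinarith [mul_le_mul_of_nonneg_right h1 (norm_nonneg x)])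
  calc Λ * ‖J x‖ ^ 2 ≤ Λ * (Λ⁻¹ * ‖x‖ ^ 2) := by gcongr
    _ = ‖x‖ ^ 2 := by field_simp

/-- A vector orthogonal to the eigenvectors of the eigenvalues `≤ Λ` satisfies the reversed
inequality. -/
lemma norm_sq_ge_of_orthogonal [CompleteSpace W] [CompleteSpace K] [CompleteSpace H]
    (hJ : IsCompactOperator J) {C : NNReal} (hL : AntilipschitzWith C L) {Λ : ℝ} {x : W}
    (hx : ∀ κ ≤ Λ, ∀ u ∈ eigenspace L J κ, ⟪J u, J x⟫_ℂ = 0) :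
    Λ * ‖J x‖ ^ 2 ≤ ‖L x‖ ^ 2 := by
  have hcl : IsClosed (range L) := hL.isClosed_range L.uniformContinuous
  -- Transporting the pencil to the range of `L` turns the form of `L` into the inner product, the
  -- case already settled.
  set e := ContinuousLinearMap.equivRange hL.injective hcl with he
  have hev : ∀ w, ((e w : L.range) : K) = L w := fun w => rfl
  have : CompleteSpace L.range := hcl.completeSpace_coe
  have h := norm_sq_ge_of_orthogonal_id (W := L.range) (J := J ∘L (e.symm : L.range →L[ℂ] W))
    (hJ.comp_clm _) (Λ := Λ) (x := e x) ?_
  · simpa [hev] using h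
  intro κ hκ u hu
  obtain ⟨w, rfl⟩ := e.surjective u
  have hw : w ∈ eigenspace L J κ := fun z => by
    have := hu (e z)
    simpa [Submodule.coe_inner, hev] using this
  rw [Submodule.coe_inner, hev, hev, hw x, hx κ hκ w hw, mul_zero]

/-- The spectral subspaces are finite-dimensional. -/
lemma finiteDimensional_spectralSubspace [CompleteSpace W]
    (hJ : IsCompactOperator J) {C : NNReal} (hL : AntilipschitzWith C L) (Λ : ℝ) :
    FiniteDimensional ℂ (spectralSubspace L J Λ) := by
  set U := spectralSubspace L J Λ
  -- The closure is used because it is complete. The form inequality survives there, so `J` is both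
  -- compact and bounded below on it, which forces finite dimension.
  have hcl : ∀ w ∈ U.topologicalClosure, ‖L w‖ ^ 2 ≤ Λ * ‖J w‖ ^ 2 := by
    intro w hw
    have hclosed : IsClosed {w : W | ‖L w‖ ^ 2 ≤ Λ * ‖J w‖ ^ 2} :=
      isClosed_le (by fun_prop) (by fun_prop)
    exact hclosed.closure_subset_iff.2 (fun w hw => norm_sq_le_of_mem_spectralSubspace hw) hw
  set T : U.topologicalClosure →L[ℂ] H := J ∘L U.topologicalClosure.subtypeL
  have hT : AntilipschitzWith (C * NNReal.sqrt Λ.toNNReal) T := by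
    refine T.antilipschitz_of_bound fun w => ?_
    have h1 : ‖(w : W)‖ ≤ C * ‖L w‖ := by
      simpa using hL.le_mul_dist (w : W) 0
    have h2 : ‖L w‖ ≤ Real.sqrt Λ.toNNReal * ‖J w‖ := by
      refine abs_le_of_sq_le_sq' ?_ (by positivity) |>.2
      rw [mul_pow, Real.sq_sqrt (by positivity)]
      exact (hcl w w.2).trans (by gcongr; exact Real.le_coe_toNNReal Λ)
    calc ‖w‖ ≤ C * ‖L w‖ := h1
      _ ≤ C * (Real.sqrt Λ.toNNReal * ‖J w‖) := by gcongr
      _ = _ := by push_cast; rw [mul_assoc]; rfl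
  have hTc : IsCompactOperator T := hJ.comp_clm _
  have : CompleteSpace U.topologicalClosure :=
    U.isClosed_topologicalClosure.completeSpace_coe
  have hemb := hT.isClosedEmbedding T.uniformContinuous
  have : FiniteDimensional ℂ U.topologicalClosure := by
    refine FiniteDimensional.of_isCompactOperator_id ?_
    obtain ⟨k, hk, hk'⟩ := hTc
    exact ⟨T ⁻¹' k, hemb.isCompact_preimage hk, hk'⟩
  exact Submodule.finiteDimensional_of_le U.le_topologicalClosure

/-- The variational upper bound for the dimension of a spectral subspace. -/
lemma finrank_le_rank_spectralSubspace [CompleteSpace W] [CompleteSpace K] [CompleteSpace H]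
    (hJ : IsCompactOperator J) {C : NNReal} (hL : AntilipschitzWith C L) {Λ Λ' : ℝ} (h : Λ < Λ')
    (X : Submodule ℂ W) [FiniteDimensional ℂ X] (hX : ∀ x ∈ X, ‖L x‖ ^ 2 ≤ Λ * ‖J x‖ ^ 2) :
    finrank ℂ X ≤ finrank ℂ (spectralSubspace L J Λ') := by
  by_contra! hlt
  have := finiteDimensional_spectralSubspace hJ hL Λ'
  set U := spectralSubspace L J Λ'
  set Q : Submodule ℂ H := U.map (J : W →ₗ[ℂ] H)
  have hQ : finrank ℂ Q ≤ finrank ℂ U := Submodule.finrank_map_le _ _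
  set P : X →ₗ[ℂ] Q := (Q.orthogonalProjectionOnto : H →ₗ[ℂ] Q) ∘ₗ (J : W →ₗ[ℂ] H) ∘ₗ X.subtype
  -- By the dimension count some nonzero vector of `X` is `J`-orthogonal to the whole spectral
  -- subspace at `Λ'`. It satisfies both form inequalities, which is impossible since `Λ < Λ'`.
  have hker : LinearMap.ker P ≠ ⊥ := LinearMap.ker_ne_bot_of_finrank_lt (hQ.trans_lt hlt)
  obtain ⟨x, hx, hx0⟩ := Submodule.exists_mem_ne_zero_of_ne_bot hker
  have hxQ : J x ∈ Qᗮ := by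
    rw [← Submodule.orthogonalProjectionOnto_eq_zero_iff]
    exact hx
  have h1 : Λ' * ‖J x‖ ^ 2 ≤ ‖L x‖ ^ 2 := norm_sq_ge_of_orthogonal hJ hL fun κ hκ u hu =>
    hxQ _ (Submodule.mem_map_of_mem (eigenspace_le_spectralSubspace hκ hu))
  have h2 := hX x x.2
  have h3 : ‖J x‖ ^ 2 ≤ 0 := by nlinarith
  have h4 : ‖L (x : W)‖ ^ 2 ≤ 0 := by
    have : ‖J (x : W)‖ ^ 2 = 0 := le_antisymm h3 (sq_nonneg _)
    rw [this, mul_zero] at h2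
    exact h2
  have h5 : L (x : W) = 0 := by
    rw [← norm_eq_zero, ← sq_eq_zero_iff]
    exact le_antisymm h4 (sq_nonneg _)
  exact hx0 (Subtype.ext (hL.injective (by simpa using h5)))

end FormPencil
end

/-! ### Discrete spectrum and the variational principle. -/

noncomputable section

namespace FormPencil

open Module End
open scoped InnerProductSpace

variable {W K H : Type*} [NormedAddCommGroup W] [InnerProductSpace ℂ W]
  [NormedAddCommGroup K] [InnerProductSpace ℂ K]
  [NormedAddCommGroup H] [InnerProductSpace ℂ H]

/-- The pencil has discrete spectrum: the form of `L` is coercive, and `J` is a compact embedding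
of an infinite-dimensional space. -/
structure IsDiscrete (L : W →L[ℂ] K) (J : W →L[ℂ] H) : Prop where
  antilipschitz : ∃ C : NNReal, AntilipschitzWith C L
  compact : IsCompactOperator J
  injective : Function.Injective J
  infinite : ¬ FiniteDimensional ℂ W

variable {L : W →L[ℂ] K} {J : W →L[ℂ] H}

namespace IsDiscrete

lemma eq_zero_of_norm_sq_le (h : IsDiscrete L J) {a b : ℝ} (hab : a < b) {w : W}
    (ha : ‖L w‖ ^ 2 ≤ a * ‖J w‖ ^ 2) (hb : b * ‖J w‖ ^ 2 ≤ ‖L w‖ ^ 2) : w = 0 := by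
  have h1 : ‖J w‖ ^ 2 ≤ 0 := by nlinarith
  have h2 : J w = 0 := by
    rw [← norm_eq_zero, ← sq_eq_zero_iff]
    exact le_antisymm h1 (sq_nonneg _)
  exact h.injective (by rw [h2, map_zero])

lemma finiteDimensional [CompleteSpace W]
    (h : IsDiscrete L J) (Λ : ℝ) :
    FiniteDimensional ℂ (spectralSubspace L J Λ) :=
  have ⟨_, hC⟩ := h.antilipschitz
  finiteDimensional_spectralSubspace h.compact hC Λ

lemma natCast_le_rank_iff [CompleteSpace W]
    (h : IsDiscrete L J) {n : ℕ} {Λ : ℝ} :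
    (n : Cardinal) ≤ Module.rank ℂ (spectralSubspace L J Λ) ↔
      n ≤ finrank ℂ (spectralSubspace L J Λ) := by
  have := h.finiteDimensional Λ
  rw [← Module.finrank_eq_rank, Nat.cast_le]

/-- The form of `L` is nonnegative, so there are no eigenvectors below 0. For `n = 0` every real `Λ`
would qualify, and the infimum would be over an unbounded set. -/
lemma nonneg_of_le_rank (h : IsDiscrete L J) {n : ℕ} (hn : 1 ≤ n) {Λ : ℝ}
    (hΛ : (n : Cardinal) ≤ Module.rank ℂ (spectralSubspace L J Λ)) : 0 ≤ Λ := by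
  by_contra! hneg
  have hbot : spectralSubspace L J Λ = ⊥ := by
    rw [eq_bot_iff]
    intro w hw
    exact h.eq_zero_of_norm_sq_le hneg (norm_sq_le_of_mem_spectralSubspace hw)
      (by simp)
  rw [hbot, rank_bot] at hΛ
  have : n = 0 := by exact_mod_cast le_antisymm hΛ zero_le
  omega

lemma bddBelow (h : IsDiscrete L J) {n : ℕ} (hn : 1 ≤ n) :
    BddBelow {Λ : ℝ | (n : Cardinal) ≤ Module.rank ℂ (spectralSubspace L J Λ)} :=
  ⟨0, fun _ hΛ => h.nonneg_of_le_rank hn hΛ⟩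

lemma exists_le_rank [CompleteSpace W] [CompleteSpace K] [CompleteSpace H]
    (h : IsDiscrete L J) (n : ℕ) :
    ∃ Λ : ℝ, (n : Cardinal) ≤ Module.rank ℂ (spectralSubspace L J Λ) := by
  have hrank : (n : Cardinal) ≤ Module.rank ℂ W := by
    refine Cardinal.natCast_le_aleph0.trans (not_lt.1 fun hlt => h.infinite ?_)
    exact Module.rank_lt_aleph0_iff.1 hlt
  obtain ⟨f, hf⟩ := exists_linearIndependent_of_le_rank hrank
  set X : Submodule ℂ W := Submodule.span ℂ (range f)
  have hX : finrank ℂ X = n := by simpa using finrank_span_eq_card hf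
  have : FiniteDimensional ℂ X := FiniteDimensional.span_of_finite ℂ (finite_range f)
  obtain ⟨c, -, hc⟩ := LinearMap.exists_antilipschitzWith ((J : W →ₗ[ℂ] H) ∘ₗ X.subtype)
    (LinearMap.ker_eq_bot.2 (h.injective.comp X.injective_subtype))
  obtain ⟨C, hC⟩ := h.antilipschitz
  -- On the finite-dimensional `X` the injective `J` is bounded below, so the form quotient is at
  -- most `(‖L‖ * c) ^ 2`; the extra 1 supplies the strict gap that the dimension bound requires.
  refine ⟨(‖L‖ * c) ^ 2 + 1, ?_⟩
  rw [h.natCast_le_rank_iff, ← hX]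
  refine finrank_le_rank_spectralSubspace h.compact hC (lt_add_one _) X fun x hx => ?_
  have h1 : ‖x‖ ≤ c * ‖J x‖ := by simpa using hc.le_mul_dist ⟨x, hx⟩ 0
  rw [← mul_pow]
  gcongr
  calc ‖L x‖ ≤ ‖L‖ * ‖x‖ := L.le_opNorm x
    _ ≤ ‖L‖ * (c * ‖J x‖) := by gcongr
    _ = _ := by ring

lemma eigenvalue_nonneg [CompleteSpace W] [CompleteSpace K] [CompleteSpace H]
    (h : IsDiscrete L J) {n : ℕ} (hn : 1 ≤ n) : 0 ≤ eigenvalue L J n :=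
  le_csInf (h.exists_le_rank n) fun _ hΛ => h.nonneg_of_le_rank hn hΛ

/-- The variational principle. -/
lemma eigenvalue_le [CompleteSpace W] [CompleteSpace K] [CompleteSpace H]
    (h : IsDiscrete L J) {n : ℕ} (hn : 1 ≤ n) {Λ : ℝ} (X : Submodule ℂ W)
    [FiniteDimensional ℂ X] (hnX : n ≤ finrank ℂ X)
    (hX : ∀ x ∈ X, ‖L x‖ ^ 2 ≤ Λ * ‖J x‖ ^ 2) : eigenvalue L J n ≤ Λ := by
  obtain ⟨C, hC⟩ := h.antilipschitz
  refine le_of_forall_gt_imp_ge_of_dense fun Λ' hΛ' => csInf_le (h.bddBelow hn) ?_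
  rw [mem_ofPred_eq, h.natCast_le_rank_iff]
  exact hnX.trans (finrank_le_rank_spectralSubspace h.compact hC hΛ' X hX)

lemma le_finrank_of_lt [CompleteSpace W] [CompleteSpace K] [CompleteSpace H]
    (h : IsDiscrete L J) {n : ℕ} {Λ : ℝ}
    (hΛ : eigenvalue L J n < Λ) : n ≤ finrank ℂ (spectralSubspace L J Λ) := by
  obtain ⟨Λ', hΛ', hlt⟩ := exists_lt_of_csInf_lt (h.exists_le_rank n) hΛ
  have := h.finiteDimensional Λ
  exact (h.natCast_le_rank_iff.1 hΛ').trans (Submodule.finrank_mono (spectralSubspace_mono hlt.le))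

/-- The infimum defining the `n`-th eigenvalue is attained. -/
lemma le_finrank_eigenvalue [CompleteSpace W] [CompleteSpace K] [CompleteSpace H]
    (h : IsDiscrete L J) (n : ℕ) :
    n ≤ finrank ℂ (spectralSubspace L J (eigenvalue L J n)) := by
  set Λ₀ := eigenvalue L J n
  -- The dimension is a natural number, so it is constant on some interval $(\Lambda_0,\Lambda]$. An
  -- eigenvector with eigenvalue in that interval would then also lie in a strictly lower spectral
  -- subspace, so it vanishes.
  obtain ⟨Λ, hΛ, hmin⟩ : ∃ Λ > Λ₀, ∀ Λ' > Λ₀,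
      finrank ℂ (spectralSubspace L J Λ) ≤ finrank ℂ (spectralSubspace L J Λ') := by
    obtain ⟨Λ, hΛ, hmin⟩ := exists_minimalFor_of_wellFoundedLT (fun Λ : ℝ => Λ₀ < Λ)
      (fun Λ => finrank ℂ (spectralSubspace L J Λ)) ⟨Λ₀ + 1, lt_add_one _⟩
    exact ⟨Λ, hΛ, fun Λ' hΛ' => (le_total _ _).elim id fun hle => hmin hΛ' hle⟩
  have hfin := h.finiteDimensional Λ
  have hle : spectralSubspace L J Λ ≤ spectralSubspace L J Λ₀ := by
    refine iSup₂_le fun κ hκ => ?_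
    rcases le_or_gt κ Λ₀ with hκ₀ | hκ₀
    · exact eigenspace_le_spectralSubspace hκ₀
    obtain ⟨κ', hκ'₀, hκ'⟩ := exists_between hκ₀
    have heq : spectralSubspace L J κ' = spectralSubspace L J Λ :=
      Submodule.eq_of_le_of_finrank_le (spectralSubspace_mono (hκ'.le.trans hκ)) (hmin κ' hκ'₀)
    intro w hw
    have hw' : w ∈ spectralSubspace L J κ' := by
      rw [heq]
      exact eigenspace_le_spectralSubspace hκ hw
    rw [h.eq_zero_of_norm_sq_le hκ' (norm_sq_le_of_mem_spectralSubspace hw')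
      (norm_sq_of_mem_eigenspace hw).ge]
    exact zero_mem _
  have := h.finiteDimensional Λ₀
  exact (h.le_finrank_of_lt hΛ).trans (Submodule.finrank_mono hle)

/-- There is a gap in the spectrum below `Λ`. -/
lemma exists_gap [CompleteSpace W]
    (h : IsDiscrete L J) (Λ : ℝ) :
    ∃ Λ' < Λ, spectralSubspace L J Λ ≤ eigenspace L J Λ ⊔ spectralSubspace L J Λ' := by
  have hfin := h.finiteDimensional
  obtain ⟨Λ', hΛ', hmax⟩ : ∃ Λ' < Λ, ∀ κ < Λ,
      finrank ℂ (spectralSubspace L J κ) ≤ finrank ℂ (spectralSubspace L J Λ') := by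
    -- Minimising the codimension maximises the dimension among the spectral subspaces strictly
    -- below `Λ`; beyond this maximum only the eigenspace at `Λ` itself is left.
    obtain ⟨Λ', hΛ', hmin⟩ := exists_minimalFor_of_wellFoundedLT (fun κ : ℝ => κ < Λ)
      (fun κ => finrank ℂ (spectralSubspace L J Λ) - finrank ℂ (spectralSubspace L J κ))
      ⟨Λ - 1, sub_one_lt _⟩
    refine ⟨Λ', hΛ', fun κ hκ => ?_⟩
    have h1 := Submodule.finrank_mono (spectralSubspace_mono (L := L) (J := J) hκ.le)
    have h2 := Submodule.finrank_mono (spectralSubspace_mono (L := L) (J := J) hΛ'.le)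
    have h3 := hmin (j := κ) hκ
    dsimp only at h3
    omega
  refine ⟨Λ', hΛ', iSup₂_le fun κ hκ => ?_⟩
  rcases eq_or_lt_of_le (show κ ≤ Λ from hκ) with rfl | hlt
  · exact le_sup_left
  refine le_sup_of_le_right ?_
  have heq : spectralSubspace L J Λ' = spectralSubspace L J (max κ Λ') :=
    Submodule.eq_of_le_of_finrank_le (spectralSubspace_mono (le_max_right _ _))
      (hmax _ (max_lt hlt hΛ'))
  rw [heq]
  exact eigenspace_le_spectralSubspace (le_max_left _ _)

end IsDiscrete

lemma inner_eq_zero_of_mem_spectralSubspace {Λ Λ' : ℝ} (h : Λ' < Λ) {g w : W}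
    (hg : g ∈ eigenspace L J Λ) (hw : w ∈ spectralSubspace L J Λ') : ⟪J g, J w⟫_ℂ = 0 := by
  have : spectralSubspace L J Λ' ≤
      LinearMap.ker ((innerSL ℂ (J g) : H →ₗ[ℂ] ℂ) ∘ₗ (J : W →ₗ[ℂ] H)) := by
    refine iSup₂_le fun κ hκ u hu => ?_
    exact inner_eq_zero_of_ne (lt_of_le_of_lt hκ h).ne' hg hu
  exact this hw

/-! ### Eigenvalues of the one-parameter family of forms. -/

section Family

variable {F : Type*} [NormedAddCommGroup F] [InnerProductSpace ℂ F]

/-- The operator whose form is `⟪L w, L z⟫ + σ ⟪Φ w, Φ z⟫`. -/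
def perturb (L : W →L[ℂ] K) (Φ : W →L[ℂ] F) (σ : ℝ) : W →L[ℂ] WithLp 2 (K × F) :=
  ((WithLp.prodContinuousLinearEquiv 2 ℂ K F).symm : K × F →L[ℂ] WithLp 2 (K × F)) ∘L
    L.prod (((Real.sqrt σ : ℝ) : ℂ) • Φ)

variable {Φ : W →L[ℂ] F} {σ : ℝ}

lemma inner_perturb (hσ : 0 ≤ σ) (w z : W) :
    ⟪perturb L Φ σ w, perturb L Φ σ z⟫_ℂ = ⟪L w, L z⟫_ℂ + σ * ⟪Φ w, Φ z⟫_ℂ := by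
  have h : ((Real.sqrt σ : ℝ) : ℂ) * ((Real.sqrt σ : ℝ) : ℂ) = σ := by
    rw [← Complex.ofReal_mul, Real.mul_self_sqrt hσ]
  rw [WithLp.prod_inner_apply]
  simp only [perturb, ContinuousLinearMap.comp_apply, ContinuousLinearEquiv.coe_coe,
    WithLp.prodContinuousLinearEquiv_symm_apply, ContinuousLinearMap.prod_apply,
    smul_apply, inner_smul_left, inner_smul_right, Complex.conj_ofReal]
  rw [← h]
  ring

lemma norm_sq_perturb (hσ : 0 ≤ σ) (w : W) :
    ‖perturb L Φ σ w‖ ^ 2 = ‖L w‖ ^ 2 + σ * ‖Φ w‖ ^ 2 := by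
  have h := inner_perturb (L := L) (Φ := Φ) hσ w w
  simp only [inner_self_eq_ofReal] at h
  exact_mod_cast h

lemma IsDiscrete.perturb (h : IsDiscrete L J) (Φ : W →L[ℂ] F) (hσ : 0 ≤ σ) :
    IsDiscrete (perturb L Φ σ) J where
  antilipschitz := by
    obtain ⟨C, hC⟩ := h.antilipschitz
    refine ⟨C, ContinuousLinearMap.antilipschitz_of_bound _ fun w => ?_⟩
    have h1 : ‖w‖ ≤ C * ‖L w‖ := by simpa using hC.le_mul_dist w 0
    have h2 : ‖L w‖ ≤ ‖FormPencil.perturb L Φ σ w‖ := by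
      refine abs_le_of_sq_le_sq' ?_ (norm_nonneg _) |>.2
      rw [norm_sq_perturb hσ]
      exact le_add_of_nonneg_right (by positivity)
    exact h1.trans (by gcongr)
  compact := h.compact
  injective := h.injective
  infinite := h.infinite

lemma IsDiscrete.exists_trace_bound (h : IsDiscrete L J) (Φ : W →L[ℂ] F) :
    ∃ D : ℝ, 0 ≤ D ∧ ∀ w, ‖Φ w‖ ^ 2 ≤ D * ‖L w‖ ^ 2 := by
  obtain ⟨C, hC⟩ := h.antilipschitz
  refine ⟨(‖Φ‖ * C) ^ 2, by positivity, fun w => ?_⟩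
  have h1 : ‖w‖ ≤ C * ‖L w‖ := by simpa using hC.le_mul_dist w 0
  rw [← mul_pow]
  gcongr
  calc ‖Φ w‖ ≤ ‖Φ‖ * ‖w‖ := Φ.le_opNorm w
    _ ≤ ‖Φ‖ * (C * ‖L w‖) := by gcongr
    _ = _ := by ring

/-- The spectral subspace at the larger parameter is a test space for the smaller one. -/
lemma eigenvalue_perturb_mono [CompleteSpace W] [CompleteSpace K]
    [CompleteSpace H] [CompleteSpace F]
    (h : IsDiscrete L J) (Φ : W →L[ℂ] F) {n : ℕ} (hn : 1 ≤ n)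
    {s t : ℝ} (hs : 0 ≤ s) (hst : s ≤ t) :
    eigenvalue (perturb L Φ s) J n ≤ eigenvalue (perturb L Φ t) J n := by
  have ht := h.perturb Φ (hs.trans hst)
  have := ht.finiteDimensional (eigenvalue (perturb L Φ t) J n)
  refine (h.perturb Φ hs).eigenvalue_le hn _ (ht.le_finrank_eigenvalue n) fun w hw => ?_
  refine le_trans ?_ (norm_sq_le_of_mem_spectralSubspace hw)
  rw [norm_sq_perturb hs, norm_sq_perturb (hs.trans hst)]
  gcongr

/-- The spectral subspace at `s` serves as test space at `t`, the increment of the form being at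
most $(t-s)D$ times the form. This crude bound is needed only for continuity. -/
lemma eigenvalue_perturb_le [CompleteSpace W] [CompleteSpace K]
    [CompleteSpace H] [CompleteSpace F]
    (h : IsDiscrete L J) {D : ℝ}
    (hD : ∀ w, ‖Φ w‖ ^ 2 ≤ D * ‖L w‖ ^ 2) (hD0 : 0 ≤ D) {n : ℕ} (hn : 1 ≤ n)
    {s t : ℝ} (hs : 0 ≤ s) (hst : s ≤ t) :
    eigenvalue (perturb L Φ t) J n ≤ (1 + (t - s) * D) * eigenvalue (perturb L Φ s) J n := by
  have hs' := h.perturb Φ hs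
  have := hs'.finiteDimensional (eigenvalue (perturb L Φ s) J n)
  refine (h.perturb Φ (hs.trans hst)).eigenvalue_le hn _ (hs'.le_finrank_eigenvalue n)
    fun w hw => ?_
  have h1 := norm_sq_le_of_mem_spectralSubspace hw
  have h2 := norm_sq_perturb (L := L) (Φ := Φ) hs w
  have h3 : 0 ≤ s * ‖Φ w‖ ^ 2 := by positivity
  have h4 : (t - s) * ‖Φ w‖ ^ 2 ≤ (t - s) * (D * ‖perturb L Φ s w‖ ^ 2) :=
    mul_le_mul_of_nonneg_left ((hD w).trans (mul_le_mul_of_nonneg_left (by linarith) hD0))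
      (by linarith)
  calc ‖perturb L Φ t w‖ ^ 2 = ‖perturb L Φ s w‖ ^ 2 + (t - s) * ‖Φ w‖ ^ 2 := by
        rw [norm_sq_perturb hs, norm_sq_perturb (hs.trans hst)]; ring
    _ ≤ (1 + (t - s) * D) * ‖perturb L Φ s w‖ ^ 2 := by linarith
    _ ≤ (1 + (t - s) * D) * (eigenvalue (perturb L Φ s) J n * ‖J w‖ ^ 2) := by
        have : 0 ≤ 1 + (t - s) * D := by nlinarith
        gcongr
    _ = _ := by ring

/-- Monotonicity and `eigenvalue_perturb_le` give the Lipschitz constant `D * N b`. -/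
lemma continuousOn_eigenvalue_perturb [CompleteSpace W] [CompleteSpace K]
    [CompleteSpace H] [CompleteSpace F]
    (h : IsDiscrete L J) (Φ : W →L[ℂ] F) {n : ℕ} (hn : 1 ≤ n)
    {a b : ℝ} (ha : 0 ≤ a) :
    ContinuousOn (fun t => eigenvalue (perturb L Φ t) J n) (Icc a b) := by
  obtain ⟨D, hD0, hD⟩ := h.exists_trace_bound Φ
  rcases lt_or_ge b a with hab | hab
  · simp [Icc_eq_empty hab.not_ge]
  set N := fun t => eigenvalue (perturb L Φ t) J n
  have hN : ∀ t ∈ Icc a b, N t ≤ N b := fun t ht =>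
    eigenvalue_perturb_mono h Φ hn (ha.trans ht.1) ht.2
  have hNb : 0 ≤ N b := (h.perturb Φ (ha.trans hab)).eigenvalue_nonneg hn
  have key : ∀ s ∈ Icc a b, ∀ t ∈ Icc a b, s ≤ t → |N t - N s| ≤ D * N b * |t - s| := by
    intro s hs t ht hst
    have h1 : N s ≤ N t := eigenvalue_perturb_mono h Φ hn (ha.trans hs.1) hst
    have h2 : N t ≤ (1 + (t - s) * D) * N s := eigenvalue_perturb_le h hD hD0 hn (ha.trans hs.1) hst
    rw [abs_of_nonneg (by linarith), abs_of_nonneg (by linarith)]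
    have h3 : (t - s) * D * N s ≤ (t - s) * D * N b :=
      mul_le_mul_of_nonneg_left (hN s hs) (mul_nonneg (by linarith) hD0)
    linarith
  refine (LipschitzOnWith.of_dist_le_mul (K := ⟨D * N b, by positivity⟩) ?_).continuousOn
  intro s hs t ht
  rw [Real.dist_eq, Real.dist_eq]
  rcases le_total s t with hst | hst
  · rw [abs_sub_comm, abs_sub_comm s]
    exact key s hs t ht hst
  · exact key t ht s hs hst

/-- First-order perturbation estimate: if `‖Φ w‖² ≤ s ‖J w‖²` on the eigenspace of the `n`-th
eigenvalue at `t`, then that eigenvalue grows to the right of `t` at a rate of at most `s`. -/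
lemma eventually_eigenvalue_perturb_le [CompleteSpace W] [CompleteSpace K]
    [CompleteSpace H] [CompleteSpace F]
    (h : IsDiscrete L J) {n : ℕ} (hn : 1 ≤ n) {t s r : ℝ}
    (ht : 0 ≤ t) (hs : 0 ≤ s) (hsr : s < r)
    (hE : ∀ w ∈ eigenspace (perturb L Φ t) J (eigenvalue (perturb L Φ t) J n),
      ‖Φ w‖ ^ 2 ≤ s * ‖J w‖ ^ 2) :
    ∃ δ₀ > 0, ∀ δ, 0 < δ → δ < δ₀ →
      eigenvalue (perturb L Φ (t + δ)) J n ≤ eigenvalue (perturb L Φ t) J n + r * δ := by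
  obtain ⟨D, hD0, hD⟩ := h.exists_trace_bound Φ
  have hd := h.perturb Φ ht
  set Λ := eigenvalue (perturb L Φ t) J n with hΛ
  have hΛ0 : 0 ≤ Λ := hd.eigenvalue_nonneg hn
  obtain ⟨Λ', hΛ', hgap⟩ := hd.exists_gap Λ
  -- Weight for Young's inequality, small enough that $(1+\varepsilon)s\le r$; the denominator `s +
  -- 1` stays positive when `s = 0`.
  set ε := (r - s) / (s + 1) with hε
  have hε0 : 0 < ε := div_pos (by linarith) (by linarith)
  have hεs : (1 + ε) * s ≤ r := by
    have : ε * (s + 1) = r - s := by rw [hε]; field_simp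
    linarith
  set M := (1 + ε⁻¹) * (D * Λ) with hM
  have hM0 : 0 ≤ M := by positivity
  -- For such `δ` the spectral gap absorbs the perturbation of the lower part: $\Lambda'+\delta
  -- M\le\Lambda$. Only the eigenspace component `g` then contributes to the growth.
  refine ⟨(Λ - Λ') / (M + 1), div_pos (by linarith) (by linarith), fun δ hδ hδ' => ?_⟩
  rw [lt_div_iff₀ (by linarith)] at hδ'
  have hfin := hd.finiteDimensional Λ
  refine (h.perturb Φ (by linarith)).eigenvalue_le hn (spectralSubspace (perturb L Φ t) J Λ)
    (hd.le_finrank_eigenvalue n) fun w hw => ?_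
  obtain ⟨g, hg, u, hu, rfl⟩ := Submodule.mem_sup.1 (hgap hw)
  have hgu := inner_eq_zero_of_mem_spectralSubspace hΛ' hg hu
  have hJ : ‖J (g + u)‖ ^ 2 = ‖J g‖ ^ 2 + ‖J u‖ ^ 2 := by
    rw [map_add, @norm_add_sq ℂ, hgu]; simp
  have hL : ‖perturb L Φ t (g + u)‖ ^ 2 = ‖perturb L Φ t g‖ ^ 2 + ‖perturb L Φ t u‖ ^ 2 := by
    rw [map_add, @norm_add_sq ℂ, hg u, hgu]; simp
  have hLg := norm_sq_of_mem_eigenspace hg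
  have hLu := norm_sq_le_of_mem_spectralSubspace hu
  have hΦg := hE g hg
  have hΦu : ‖Φ u‖ ^ 2 ≤ D * (Λ * ‖J u‖ ^ 2) := by
    refine (hD u).trans (mul_le_mul_of_nonneg_left ?_ hD0)
    have h1 : ‖L u‖ ^ 2 ≤ ‖perturb L Φ t u‖ ^ 2 := by
      rw [norm_sq_perturb ht]
      exact le_add_of_nonneg_right (by positivity)
    have h2 : Λ' * ‖J u‖ ^ 2 ≤ Λ * ‖J u‖ ^ 2 := by gcongr
    linarith
  have hΦ : ‖Φ (g + u)‖ ^ 2 ≤ (1 + ε) * ‖Φ g‖ ^ 2 + (1 + ε⁻¹) * ‖Φ u‖ ^ 2 := by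
    have h1 : ‖Φ (g + u)‖ ≤ ‖Φ g‖ + ‖Φ u‖ := by rw [map_add]; exact norm_add_le _ _
    have h2 : ‖Φ (g + u)‖ ^ 2 ≤ (‖Φ g‖ + ‖Φ u‖) ^ 2 := by gcongr
    have h3 : 0 ≤ ε⁻¹ * (ε * ‖Φ g‖ - ‖Φ u‖) ^ 2 := by positivity
    have h4 : ε⁻¹ * (ε * ‖Φ g‖ - ‖Φ u‖) ^ 2
        = ε * ‖Φ g‖ ^ 2 - 2 * ‖Φ g‖ * ‖Φ u‖ + ε⁻¹ * ‖Φ u‖ ^ 2 := by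
      field_simp
      ring
    linarith
  have hΦ' : ‖Φ (g + u)‖ ^ 2 ≤ r * ‖J g‖ ^ 2 + M * ‖J u‖ ^ 2 := by
    have h1 : (1 + ε) * ‖Φ g‖ ^ 2 ≤ (1 + ε) * (s * ‖J g‖ ^ 2) := by gcongr
    have h2 : (1 + ε⁻¹) * ‖Φ u‖ ^ 2 ≤ (1 + ε⁻¹) * (D * (Λ * ‖J u‖ ^ 2)) := by gcongr
    have h3 : (1 + ε) * s * ‖J g‖ ^ 2 ≤ r * ‖J g‖ ^ 2 := by gcongr
    have h4 : M * ‖J u‖ ^ 2 = (1 + ε⁻¹) * (D * (Λ * ‖J u‖ ^ 2)) := by rw [hM]; ring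
    linarith
  have hfinal : ‖perturb L Φ (t + δ) (g + u)‖ ^ 2
      = ‖perturb L Φ t (g + u)‖ ^ 2 + δ * ‖Φ (g + u)‖ ^ 2 := by
    rw [norm_sq_perturb ht, norm_sq_perturb (by linarith)]; ring
  rw [hfinal, hL, hJ, hLg]
  have h5 : δ * ‖Φ (g + u)‖ ^ 2 ≤ δ * (r * ‖J g‖ ^ 2 + M * ‖J u‖ ^ 2) := by gcongr
  have h6 : (Λ' + δ * M) * ‖J u‖ ^ 2 ≤ (Λ + r * δ) * ‖J u‖ ^ 2 := by
    refine mul_le_mul_of_nonneg_right ?_ (sq_nonneg _)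
    have : 0 ≤ r * δ := mul_nonneg (by linarith) hδ.le
    linarith
  linarith

/-- If `‖Φ w‖² ≤ s ‖J w‖²` on the eigenspaces of the `n`-th eigenvalue along `[a, b)`, then that
eigenvalue grows by at most `s (b - a)`. -/
lemma eigenvalue_perturb_le_add [CompleteSpace W] [CompleteSpace K]
    [CompleteSpace H] [CompleteSpace F]
    (h : IsDiscrete L J) {n : ℕ} (hn : 1 ≤ n) {a b s : ℝ}
    (ha : 0 ≤ a) (hab : a ≤ b) (hs : 0 ≤ s)
    (hE : ∀ t ∈ Ico a b, ∀ w ∈ eigenspace (perturb L Φ t) J (eigenvalue (perturb L Φ t) J n),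
      ‖Φ w‖ ^ 2 ≤ s * ‖J w‖ ^ 2) :
    eigenvalue (perturb L Φ b) J n ≤ eigenvalue (perturb L Φ a) J n + s * (b - a) := by
  -- A continuous function whose right slopes are eventually below every $r>s$ stays under the line
  -- of slope `s`.
  have := image_le_of_liminf_slope_right_le_deriv_boundary
    (f := fun t => eigenvalue (perturb L Φ t) J n) (a := a) (b := b)
    (B := fun t => eigenvalue (perturb L Φ a) J n + s * (t - a)) (B' := fun _ => s)
    (continuousOn_eigenvalue_perturb h Φ hn ha) (by simp) (by fun_prop)
    (fun x _ => by
      simpa using ((((hasDerivAt_id x).sub_const a).const_mul s).const_add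
        (eigenvalue (perturb L Φ a) J n)).hasDerivWithinAt)
    (fun x hx r hr => ?_)
  · exact this (right_mem_Icc.2 hab)
  obtain ⟨r', hr', hr'r⟩ := exists_between hr
  obtain ⟨δ₀, hδ₀, hδ⟩ := eventually_eigenvalue_perturb_le h hn (ha.trans hx.1) hs hr' (hE x hx)
  refine Filter.Eventually.frequently ?_
  filter_upwards [Ioo_mem_nhdsGT (show x < x + δ₀ by linarith)] with z hz
  have h1 := hδ (z - x) (by linarith [hz.1]) (by linarith [hz.2])
  rw [add_sub_cancel] at h1
  have h2 : 0 < z - x := by linarith [hz.1]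
  rw [slope_def_field, div_lt_iff₀ h2]
  linarith [mul_lt_mul_of_pos_right hr'r h2]

end Family

end FormPencil
end

/-! ### $L^2$ of an interval: the Volterra operator and integration by parts. -/

noncomputable section

namespace IntervalL2

open scoped InnerProductSpace ComplexConjugate

variable {ℓ : ℝ}

lemma integrableOn (g : Lp ℂ 2 (volume.restrict (Icc 0 ℓ))) : IntegrableOn g (Icc 0 ℓ) :=
  (Lp.memLp g).integrable (by norm_num)

lemma memLp_of_continuousOn {f : ℝ → ℂ} (hf : ContinuousOn f (Icc 0 ℓ)) :
    MemLp f 2 (volume.restrict (Icc 0 ℓ)) := by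
  obtain ⟨C, hC⟩ := isCompact_Icc.exists_bound_of_continuousOn hf
  exact MemLp.of_bound (hf.aestronglyMeasurable measurableSet_Icc) C
    ((ae_restrict_iff' measurableSet_Icc).2 (ae_of_all _ hC))

/-- Integration over `[a, b] ⊆ [0, ℓ]` as a continuous functional on `L²(0, ℓ)`. -/
def integralL (ℓ a b : ℝ) : Lp ℂ 2 (volume.restrict (Icc 0 ℓ)) →L[ℂ] ℂ :=
  innerSL ℂ (indicatorConstLp 2 (measurableSet_Ioc (a := a) (b := b))
    (measure_ne_top (volume.restrict (Icc 0 ℓ)) _) (1 : ℂ))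

lemma integralL_apply {a b : ℝ} (ha : 0 ≤ a) (hab : a ≤ b) (hb : b ≤ ℓ)
    (g : Lp ℂ 2 (volume.restrict (Icc 0 ℓ))) :
    integralL ℓ a b g = ∫ t in a..b, g t := by
  rw [integralL, innerSL_apply_apply, L2.inner_indicatorConstLp_one,
    Measure.restrict_restrict measurableSet_Ioc, intervalIntegral.integral_of_le hab]
  congr 2
  exact inter_eq_left.2 (Ioc_subset_Icc_self.trans (Icc_subset_Icc ha hb))

/-- Cauchy–Schwarz against the indicator of $(a,b]$. The factor $\sqrt{b-a}$ is what makes the step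
approximations of the Volterra operator converge in norm. -/
lemma norm_integral_le {a b : ℝ} (ha : 0 ≤ a) (hab : a ≤ b) (hb : b ≤ ℓ)
    (g : Lp ℂ 2 (volume.restrict (Icc 0 ℓ))) :
    ‖∫ t in a..b, g t‖ ≤ Real.sqrt (b - a) * ‖g‖ := by
  rw [← integralL_apply ha hab hb, integralL, innerSL_apply_apply]
  refine (norm_inner_le_norm _ _).trans (mul_le_mul_of_nonneg_right ?_ (norm_nonneg _))
  rw [norm_indicatorConstLp (by norm_num) (by norm_num), measureReal_restrict_apply
    measurableSet_Ioc, inter_eq_left.2 (Ioc_subset_Icc_self.trans (Icc_subset_Icc ha hb)),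
    Real.volume_real_Ioc_of_le hab, Real.sqrt_eq_rpow]
  norm_num

lemma continuousOn_primitive (hℓ : 0 < ℓ) {g : ℝ → ℂ} (hg : IntegrableOn g (Icc 0 ℓ)) :
    ContinuousOn (fun x => ∫ t in (0 : ℝ)..x, g t) (Icc 0 ℓ) :=
  IsSobolevTwo.continuousOn_of_eq_integral hℓ hg (by simp)

lemma integral_congr_ae_Icc {x : ℝ} {f g : ℝ → ℂ} (h : f =ᵐ[volume.restrict (Icc 0 ℓ)] g)
    (hx : x ∈ Icc 0 ℓ) :
    ∫ t in (0 : ℝ)..x, f t = ∫ t in (0 : ℝ)..x, g t := by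
  rw [intervalIntegral.integral_of_le hx.1, intervalIntegral.integral_of_le hx.1]
  exact integral_congr_ae (ae_restrict_of_ae_restrict_of_subset
    (Ioc_subset_Icc_self.trans (Icc_subset_Icc_right hx.2)) h)

lemma integral_primitive_add {f g : ℝ → ℂ} (hf : IntegrableOn f (Icc 0 ℓ))
    (hg : IntegrableOn g (Icc 0 ℓ)) {x : ℝ} (hx : x ∈ Icc 0 ℓ) :
    ∫ t in (0 : ℝ)..x, (f t + g t) = (∫ t in (0 : ℝ)..x, f t) + ∫ t in (0 : ℝ)..x, g t :=
  intervalIntegral.integral_add (IsSobolevTwo.intervalIntegrable_of_integrableOn hf hx)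
    (IsSobolevTwo.intervalIntegrable_of_integrableOn hg hx)

lemma norm_le_of_ae_le (hℓ : 0 < ℓ) {f : Lp ℂ 2 (volume.restrict (Icc 0 ℓ))} {C : ℝ} (hC : 0 ≤ C)
    (h : ∀ᵐ x ∂volume.restrict (Icc 0 ℓ), ‖f x‖ ≤ C) : ‖f‖ ≤ Real.sqrt ℓ * C := by
  refine (Lp.norm_le_of_ae_bound hC h).trans (le_of_eq ?_)
  have : (measureUnivNNReal (volume.restrict (Icc 0 ℓ)) : ℝ) = ℓ := by
    rw [measureUnivNNReal]
    rw [Measure.restrict_apply_univ, Real.volume_Icc, sub_zero]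
    exact ENNReal.toReal_ofReal hℓ.le
  rw [this, Real.sqrt_eq_rpow]
  norm_num

/-- The Volterra operator `g ↦ ∫₀ˣ g` on `L²(0, ℓ)`. -/
def volterra (hℓ : 0 < ℓ) :
    Lp ℂ 2 (volume.restrict (Icc 0 ℓ)) →L[ℂ] Lp ℂ 2 (volume.restrict (Icc 0 ℓ)) :=
  LinearMap.mkContinuous
    { toFun := fun g => (memLp_of_continuousOn (continuousOn_primitive hℓ (integrableOn g))).toLp _
      map_add' := fun f g => by
        rw [← MemLp.toLp_add, MemLp.toLp_eq_toLp_iff]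
        refine (ae_restrict_iff' measurableSet_Icc).2 (ae_of_all _ fun x hx => ?_)
        refine (integral_congr_ae_Icc (Lp.coeFn_add f g) hx).trans ?_
        exact integral_primitive_add (integrableOn f) (integrableOn g) hx
      map_smul' := fun c g => by
        rw [RingHom.id_apply, ← MemLp.toLp_const_smul, MemLp.toLp_eq_toLp_iff]
        refine (ae_restrict_iff' measurableSet_Icc).2 (ae_of_all _ fun x hx => ?_)
        refine (integral_congr_ae_Icc (Lp.coeFn_smul c g) hx).trans ?_
        exact intervalIntegral.integral_smul c g }
    (Real.sqrt ℓ * Real.sqrt ℓ) (fun g => by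
      rw [mul_assoc]
      refine norm_le_of_ae_le hℓ (by positivity) ?_
      filter_upwards [MemLp.coeFn_toLp (memLp_of_continuousOn (continuousOn_primitive hℓ
        (integrableOn g))), ae_restrict_mem measurableSet_Icc] with x hx hxI
      simp only [LinearMap.coe_mk, AddHom.coe_mk, hx]
      refine (norm_integral_le le_rfl hxI.1 hxI.2 g).trans ?_
      gcongr
      linarith [hxI.2])

lemma coeFn_volterra (hℓ : 0 < ℓ) (g : Lp ℂ 2 (volume.restrict (Icc 0 ℓ))) :
    volterra hℓ g =ᵐ[volume.restrict (Icc 0 ℓ)] fun x => ∫ t in (0 : ℝ)..x, g t :=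
  MemLp.coeFn_toLp (memLp_of_continuousOn (continuousOn_primitive hℓ (integrableOn g)))

/-- A step-function approximation of the Volterra operator. -/
def volterraStep (ℓ : ℝ) (N : ℕ) :
    Lp ℂ 2 (volume.restrict (Icc 0 ℓ)) →L[ℂ] Lp ℂ 2 (volume.restrict (Icc 0 ℓ)) :=
  ∑ k ∈ Finset.range N, (integralL ℓ 0 (k * (ℓ / N))).smulRight
    (indicatorConstLp 2 (measurableSet_Ioc (a := (k * (ℓ / N) : ℝ)) (b := (k + 1) * (ℓ / N)))
      (measure_ne_top (volume.restrict (Icc 0 ℓ)) _) (1 : ℂ))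

lemma isCompactOperator_volterraStep (N : ℕ) : IsCompactOperator (volterraStep ℓ N) := by
  change volterraStep ℓ N ∈ compactOperator (RingHom.id ℂ) _ _
  refine Submodule.sum_mem _ fun k _ => ?_
  have h : IsCompactOperator (integralL ℓ 0 (k * (ℓ / N))) :=
    isCompactOperator_of_locallyCompactSpace_dom _
  exact h.clm_comp (ContinuousLinearMap.toSpanSingleton ℂ _)

lemma exists_mem_Ioc_step {N : ℕ} (hN : 0 < N) {x : ℝ} (hx : x ∈ Ioc 0 ℓ) :
    ∃ k < N, x ∈ Ioc (k * (ℓ / N)) ((k + 1) * (ℓ / N)) := by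
  have hℓ : 0 < ℓ := hx.1.trans_le hx.2
  have hN' : (0 : ℝ) < N := by exact_mod_cast hN
  have hs : 0 < ℓ / N := by positivity
  have hpos : 0 < ⌈x / (ℓ / N)⌉₊ := Nat.ceil_pos.2 (div_pos hx.1 hs)
  -- The cells are open on the left, so the index is the ceiling minus one.
  obtain ⟨k, hk⟩ := Nat.exists_eq_succ_of_ne_zero hpos.ne'
  have h1 : x ≤ (k + 1) * (ℓ / N) := by
    rw [← div_le_iff₀ hs]
    have := Nat.le_ceil (x / (ℓ / N))
    rw [hk] at this
    exact_mod_cast this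
  have h2 : (k : ℝ) * (ℓ / N) < x := by
    rw [← lt_div_iff₀ hs]
    exact Nat.lt_ceil.1 (by omega)
  refine ⟨k, ?_, h2, h1⟩
  have h3 : (k : ℝ) * (ℓ / N) < N * (ℓ / N) := by
    rw [mul_div_cancel₀ ℓ hN'.ne']
    exact h2.trans_le hx.2
  exact_mod_cast lt_of_mul_lt_mul_right h3 hs.le

lemma coeFn_volterraStep {N : ℕ} (g : Lp ℂ 2 (volume.restrict (Icc 0 ℓ))) :
    ∀ᵐ x ∂volume.restrict (Icc 0 ℓ), ∀ k < N, x ∈ Ioc ((k : ℝ) * (ℓ / N)) ((k + 1) * (ℓ / N)) →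
      volterraStep ℓ N g x = integralL ℓ 0 (k * (ℓ / N)) g := by
  have hsum := Lp.coeFn_finsetSum (Finset.range N) (fun k =>
    integralL ℓ 0 (k * (ℓ / N)) g • indicatorConstLp 2 (μ := volume.restrict (Icc 0 ℓ))
      (measurableSet_Ioc (a := (k * (ℓ / N) : ℝ)) (b := (k + 1) * (ℓ / N)))
      (measure_ne_top (volume.restrict (Icc 0 ℓ)) _) (1 : ℂ))
  have hterm : ∀ᵐ x ∂volume.restrict (Icc 0 ℓ), ∀ k : ℕ,
      (integralL ℓ 0 (k * (ℓ / N)) g • indicatorConstLp 2 (μ := volume.restrict (Icc 0 ℓ))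
      (measurableSet_Ioc (a := (k * (ℓ / N) : ℝ)) (b := (k + 1) * (ℓ / N)))
      (measure_ne_top (volume.restrict (Icc 0 ℓ)) _) (1 : ℂ) : Lp ℂ 2 (volume.restrict (Icc 0 ℓ))) x =
      integralL ℓ 0 (k * (ℓ / N)) g •
        (Ioc ((k : ℝ) * (ℓ / N)) ((k + 1) * (ℓ / N))).indicator (fun _ => (1 : ℂ)) x := by
    rw [ae_all_iff]
    intro k
    filter_upwards [Lp.coeFn_smul (integralL ℓ 0 (k * (ℓ / N)) g)
      (indicatorConstLp 2 (μ := volume.restrict (Icc 0 ℓ))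
      (measurableSet_Ioc (a := (k * (ℓ / N) : ℝ)) (b := (k + 1) * (ℓ / N)))
      (measure_ne_top (volume.restrict (Icc 0 ℓ)) _) (1 : ℂ)),
      indicatorConstLp_coeFn (p := 2) (μ := volume.restrict (Icc 0 ℓ))
      (hs := measurableSet_Ioc (a := (k * (ℓ / N) : ℝ)) (b := (k + 1) * (ℓ / N)))
      (hμs := measure_ne_top (volume.restrict (Icc 0 ℓ)) _) (c := (1 : ℂ))] with x h1 h2
    rw [h1, Pi.smul_apply, h2]
  filter_upwards [hsum, hterm] with x h1 h2 k hk hx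
  have h3 : volterraStep ℓ N g = ∑ k ∈ Finset.range N,
      integralL ℓ 0 (k * (ℓ / N)) g • indicatorConstLp 2 (μ := volume.restrict (Icc 0 ℓ))
      (measurableSet_Ioc (a := (k * (ℓ / N) : ℝ)) (b := (k + 1) * (ℓ / N)))
      (measure_ne_top (volume.restrict (Icc 0 ℓ)) _) (1 : ℂ) := by
    simp [volterraStep]
  have hs : 0 < ℓ / N := by
    have := hx.1.trans_le hx.2
    linarith
  rw [h3, h1, Finset.sum_apply, Finset.sum_eq_single k]
  · rw [h2, indicator_of_mem hx, smul_eq_mul, mul_one]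
  · intro j _ hj
    rw [h2, indicator_of_notMem, smul_zero]
    intro hxj
    rcases lt_or_gt_of_ne hj with hlt | hlt
    · have : ((j : ℝ) + 1) * (ℓ / N) ≤ k * (ℓ / N) := by
        gcongr
        exact_mod_cast hlt
      linarith [hx.1, hxj.2]
    · have : ((k : ℝ) + 1) * (ℓ / N) ≤ j * (ℓ / N) := by
        gcongr
        exact_mod_cast hlt
      linarith [hx.2, hxj.1]
  · exact fun h => absurd (Finset.mem_range.2 hk) h

/-- On each cell the approximation freezes the primitive at the left end, so the error is an
integral of `g` over length at most `ℓ / N`. -/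
lemma norm_volterra_sub_step_le (hℓ : 0 < ℓ) {N : ℕ} (hN : 0 < N) :
    ‖volterra hℓ - volterraStep ℓ N‖ ≤ Real.sqrt ℓ * Real.sqrt (ℓ / N) := by
  refine ContinuousLinearMap.opNorm_le_bound _ (by positivity) fun g => ?_
  rw [mul_assoc, sub_apply]
  refine norm_le_of_ae_le hℓ (by positivity) ?_
  have hIoc : ∀ᵐ x ∂volume.restrict (Icc 0 ℓ), x ∈ Ioc 0 ℓ := by
    rw [← restrict_Ioc_eq_restrict_Icc]
    exact ae_restrict_mem measurableSet_Ioc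
  filter_upwards [Lp.coeFn_sub (volterra hℓ g) (volterraStep ℓ N g), coeFn_volterra hℓ g,
    coeFn_volterraStep (N := N) g, hIoc] with x h1 h2 h3 hx
  obtain ⟨k, hk, hxk⟩ := exists_mem_Ioc_step hN hx
  have hN' : (0 : ℝ) < N := by exact_mod_cast hN
  have hk0 : 0 ≤ (k : ℝ) * (ℓ / N) := by positivity
  rw [h1, Pi.sub_apply, h2, h3 k hk hxk, integralL_apply le_rfl hk0 (hxk.1.le.trans hx.2),
    intervalIntegral.integral_interval_sub_left
      (IsSobolevTwo.intervalIntegrable_of_integrableOn (integrableOn g) (Ioc_subset_Icc_self hx))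
      (IsSobolevTwo.intervalIntegrable_of_integrableOn (integrableOn g)
        ⟨hk0, hxk.1.le.trans hx.2⟩)]
  refine (norm_integral_le hk0 hxk.1.le hx.2 g).trans ?_
  gcongr
  linarith [hxk.2]

/-- The Volterra operator is compact. -/
lemma isCompactOperator_volterra (hℓ : 0 < ℓ) : IsCompactOperator (volterra hℓ) := by
  refine isCompactOperator_of_tendsto (l := Filter.atTop) (F := fun N : ℕ => volterraStep ℓ N) ?_
    (Filter.Eventually.of_forall fun N => isCompactOperator_volterraStep N)
  rw [tendsto_iff_norm_sub_tendsto_zero]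
  have h : Filter.Tendsto (fun N : ℕ => Real.sqrt ℓ * Real.sqrt (ℓ / N)) Filter.atTop (nhds 0) := by
    have h1 := (Real.continuous_sqrt.tendsto 0).comp (tendsto_const_div_atTop_nhds_zero_nat ℓ)
    rw [Real.sqrt_zero] at h1
    simpa using h1.const_mul (Real.sqrt ℓ)
  refine squeeze_zero' (Filter.Eventually.of_forall fun _ => norm_nonneg _) ?_ h
  filter_upwards [Filter.eventually_gt_atTop 0] with N hN
  rw [norm_sub_rev]
  exact norm_volterra_sub_step_le hℓ hN

/-- Fubini: the two terms are the integrals of $a(x)b(t)$ over the parts of the square on either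
side of the diagonal. -/
lemma integral_mul_primitive_add {ℓ : ℝ} (hℓ : 0 < ℓ) {a b : ℝ → ℂ}
    (ha : IntegrableOn a (Icc 0 ℓ)) (hb : IntegrableOn b (Icc 0 ℓ)) :
    (∫ x in (0 : ℝ)..ℓ, a x * ∫ t in (0 : ℝ)..x, b t) +
      ∫ t in (0 : ℝ)..ℓ, (∫ x in (0 : ℝ)..t, a x) * b t =
      (∫ x in (0 : ℝ)..ℓ, a x) * ∫ t in (0 : ℝ)..ℓ, b t := by
  have ha' : IntegrableOn a (Ioc 0 ℓ) := ha.mono_set Ioc_subset_Icc_self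
  have hb' : IntegrableOn b (Ioc 0 ℓ) := hb.mono_set Ioc_subset_Icc_self
  simp only [intervalIntegral.integral_of_le hℓ.le]
  set μ := (volume : Measure ℝ).restrict (Ioc 0 ℓ) with hμ
  have hprod : Integrable (fun z : ℝ × ℝ => a z.1 * b z.2) (μ.prod μ) := Integrable.mul_prod ha' hb'
  have hm : MeasurableSet {z : ℝ × ℝ | z.2 ≤ z.1} := measurableSet_le measurable_snd measurable_fst
  have hi := hprod.indicator hm
  have hic := hprod.indicator hm.compl
  have h1 : ∫ x, (a x * ∫ t in (0 : ℝ)..x, b t) ∂μ =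
      ∫ z, {z : ℝ × ℝ | z.2 ≤ z.1}.indicator (fun z : ℝ × ℝ => a z.1 * b z.2) z ∂(μ.prod μ) := by
    rw [integral_prod _ hi]
    refine integral_congr_ae ?_
    filter_upwards [ae_restrict_mem measurableSet_Ioc] with x hx
    have : ∀ t, {z : ℝ × ℝ | z.2 ≤ z.1}.indicator (fun z : ℝ × ℝ => a z.1 * b z.2) (x, t) =
        a x * (Iic x).indicator b t := fun t => by
      by_cases h : t ≤ x <;> simp [indicator, h]
    simp only [this]
    rw [integral_const_mul, integral_indicator measurableSet_Iic, hμ,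
      Measure.restrict_restrict measurableSet_Iic, intervalIntegral.integral_of_le hx.1.le]
    congr 3
    ext t
    simp only [mem_Ioc, mem_inter_iff, mem_Iic]
    exact ⟨fun h => ⟨h.2, h.1, h.2.trans hx.2⟩, fun h => ⟨h.2.1, h.1⟩⟩
  have h2 : ∫ t, (∫ x in (0 : ℝ)..t, a x) * b t ∂μ =
      ∫ z, {z : ℝ × ℝ | z.2 ≤ z.1}ᶜ.indicator (fun z : ℝ × ℝ => a z.1 * b z.2) z ∂(μ.prod μ) := by
    rw [integral_prod_symm _ hic]
    refine integral_congr_ae ?_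
    filter_upwards [ae_restrict_mem measurableSet_Ioc] with t ht
    have : ∀ x, {z : ℝ × ℝ | z.2 ≤ z.1}ᶜ.indicator (fun z : ℝ × ℝ => a z.1 * b z.2) (x, t) =
        (Iio t).indicator a x * b t := fun x => by
      by_cases h : t ≤ x <;> simp [indicator, h, not_lt.2]
    simp only [this]
    rw [integral_mul_const, integral_indicator measurableSet_Iio, hμ,
      Measure.restrict_restrict measurableSet_Iio, intervalIntegral.integral_of_le ht.1.le,
      integral_Ioc_eq_integral_Ioo]
    congr 3
    ext x
    simp only [mem_Ioc, mem_inter_iff, mem_Iio, mem_Ioo]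
    exact ⟨fun h => ⟨h.2, h.1, h.2.le.trans ht.2⟩, fun h => ⟨h.2.1, h.1⟩⟩
  rw [h1, h2, ← integral_add hi hic, ← integral_prod_mul]
  congr 1
  ext z
  exact indicator_self_add_compl_apply _ _ _
/-- Integration by parts for absolutely continuous functions. -/
lemma integral_mul_add_mul (hℓ : 0 < ℓ) {A a B b : ℝ → ℂ}
    (ha : IntegrableOn a (Icc 0 ℓ)) (hb : IntegrableOn b (Icc 0 ℓ))
    (hA : ∀ x ∈ Icc (0 : ℝ) ℓ, A x = A 0 + ∫ t in (0 : ℝ)..x, a t)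
    (hB : ∀ x ∈ Icc (0 : ℝ) ℓ, B x = B 0 + ∫ t in (0 : ℝ)..x, b t) :
    (∫ x in (0 : ℝ)..ℓ, a x * B x) + ∫ x in (0 : ℝ)..ℓ, A x * b x = A ℓ * B ℓ - A 0 * B 0 := by
  have hmem : ℓ ∈ Icc (0 : ℝ) ℓ := right_mem_Icc.2 hℓ.le
  have hai := IsSobolevTwo.intervalIntegrable_of_integrableOn ha hmem
  have hbi := IsSobolevTwo.intervalIntegrable_of_integrableOn hb hmem
  have hca := continuousOn_primitive hℓ ha
  have hcb := continuousOn_primitive hℓ hb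
  rw [← uIcc_of_le hℓ.le] at hca hcb
  have h1 : ∫ x in (0 : ℝ)..ℓ, a x * B x =
      (∫ x in (0 : ℝ)..ℓ, a x) * B 0 + ∫ x in (0 : ℝ)..ℓ, a x * ∫ t in (0 : ℝ)..x, b t := by
    rw [← intervalIntegral.integral_mul_const,
      ← intervalIntegral.integral_add (hai.mul_const _) (hai.mul_continuousOn hcb)]
    refine intervalIntegral.integral_congr fun x hx => ?_
    rw [uIcc_of_le hℓ.le] at hx
    simp only [hB x hx]
    ring
  have h2 : ∫ x in (0 : ℝ)..ℓ, A x * b x =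
      A 0 * (∫ x in (0 : ℝ)..ℓ, b x) + ∫ x in (0 : ℝ)..ℓ, (∫ t in (0 : ℝ)..x, a t) * b x := by
    rw [← intervalIntegral.integral_const_mul,
      ← intervalIntegral.integral_add (hbi.const_mul _) (hbi.continuousOn_mul hca)]
    refine intervalIntegral.integral_congr fun x hx => ?_
    rw [uIcc_of_le hℓ.le] at hx
    simp only [hA x hx]
    ring
  rw [h1, h2, hA ℓ hmem, hB ℓ hmem]
  linear_combination integral_mul_primitive_add hℓ ha hb

/-- Integration by parts in sesquilinear form. -/
lemma integral_conj_mul_add (hℓ : 0 < ℓ) {A a B b : ℝ → ℂ}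
    (ha : IntegrableOn a (Icc 0 ℓ)) (hb : IntegrableOn b (Icc 0 ℓ))
    (hA : ∀ x ∈ Icc (0 : ℝ) ℓ, A x = A 0 + ∫ t in (0 : ℝ)..x, a t)
    (hB : ∀ x ∈ Icc (0 : ℝ) ℓ, B x = B 0 + ∫ t in (0 : ℝ)..x, b t) :
    (∫ x in Icc 0 ℓ, conj (a x) * B x) + ∫ x in Icc 0 ℓ, conj (A x) * b x =
      conj (A ℓ) * B ℓ - conj (A 0) * B 0 := by
  have h := integral_mul_add_mul hℓ (A := fun x => conj (A x)) (a := fun x => conj (a x))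
    (B := B) (b := b) ((LinearIsometryEquiv.integrable_comp_iff Complex.conjLIE).2 ha) hb
    (fun x hx => ?_) hB
  · simpa only [intervalIntegral.integral_of_le hℓ.le, integral_Icc_eq_integral_Ioc] using h
  · rw [hA x hx, map_add, intervalIntegral.integral_of_le hx.1,
      intervalIntegral.integral_of_le hx.1, integral_conj]

lemma inner_eq_integral (f g : Lp ℂ 2 (volume.restrict (Icc 0 ℓ))) {u v : ℝ → ℂ}
    (hf : f =ᵐ[volume.restrict (Icc 0 ℓ)] u) (hg : g =ᵐ[volume.restrict (Icc 0 ℓ)] v) :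
    ⟪f, g⟫_ℂ = ∫ x in Icc 0 ℓ, conj (u x) * v x := by
  rw [L2.inner_def]
  refine integral_congr_ae ?_
  filter_upwards [hf, hg] with x h1 h2
  rw [h1, h2, RCLike.inner_apply, mul_comm]

lemma norm_sq_eq_integral (f : Lp ℂ 2 (volume.restrict (Icc 0 ℓ))) {u : ℝ → ℂ}
    (hf : f =ᵐ[volume.restrict (Icc 0 ℓ)] u) : ‖f‖ ^ 2 = ∫ x in Icc 0 ℓ, ‖u x‖ ^ 2 := by
  have h := inner_eq_integral f f hf hf
  rw [FormPencil.inner_self_eq_ofReal] at h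
  have h2 : ∀ x, conj (u x) * u x = ((‖u x‖ ^ 2 : ℝ) : ℂ) := fun x => by
    rw [Complex.conj_mul', Complex.ofReal_pow]
  simp only [h2] at h
  rw [integral_complex_ofReal] at h
  exact_mod_cast h

end IntervalL2
end

noncomputable section

namespace IntervalL2

variable {ℓ : ℝ}

lemma norm_sq_const (hℓ : 0 < ℓ) {f : Lp ℂ 2 (volume.restrict (Icc 0 ℓ))} {c : ℂ}
    (hf : f =ᵐ[volume.restrict (Icc 0 ℓ)] fun _ => c) : ‖f‖ ^ 2 = ℓ * ‖c‖ ^ 2 := by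
  rw [norm_sq_eq_integral f hf]
  simp [hℓ.le]

/-- Polynomials embed: one vanishing almost everywhere on the interval has infinitely many roots. -/
lemma not_finiteDimensional (hℓ : 0 < ℓ) :
    ¬ FiniteDimensional ℂ (Lp ℂ 2 (volume.restrict (Icc (0 : ℝ) ℓ))) := by
  intro hfin
  have hc : ∀ p : Polynomial ℂ, ContinuousOn (fun x : ℝ => p.eval (x : ℂ)) (Icc 0 ℓ) := fun p =>
    (p.continuous.comp Complex.continuous_ofReal).continuousOn
  let T : Polynomial ℂ →ₗ[ℂ] Lp ℂ 2 (volume.restrict (Icc (0 : ℝ) ℓ)) :=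
    { toFun := fun p => (memLp_of_continuousOn (hc p)).toLp _
      map_add' := fun p q => by
        rw [← MemLp.toLp_add, MemLp.toLp_eq_toLp_iff]
        exact ae_of_all _ fun x => by simp
      map_smul' := fun c p => by
        rw [RingHom.id_apply, ← MemLp.toLp_const_smul, MemLp.toLp_eq_toLp_iff]
        exact ae_of_all _ fun x => by simp }
  have hT : Function.Injective T := by
    rw [← LinearMap.ker_eq_bot, LinearMap.ker_eq_bot']
    intro p hp
    have h1 : (fun x : ℝ => p.eval (x : ℂ)) =ᵐ[volume.restrict (Icc 0 ℓ)] 0 := by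
      refine (MemLp.coeFn_toLp (memLp_of_continuousOn (hc p))).symm.trans ?_
      change (T p : ℝ → ℂ) =ᵐ[volume.restrict (Icc 0 ℓ)] 0
      rw [hp]
      exact Lp.coeFn_zero _ _ _
    have h2 := Measure.eqOn_Icc_of_ae_eq volume hℓ.ne h1 (hc p) continuousOn_const
    refine p.eq_zero_of_infinite_isRoot ?_
    refine ((Icc_infinite hℓ).image (Complex.ofReal_injective.injOn)).mono ?_
    rintro _ ⟨x, hx, rfl⟩
    exact h2 hx
  exact Polynomial.not_finite (R := ℂ) (Module.Finite.of_injective T hT)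

lemma not_finiteDimensional_ker (hℓ : 0 < ℓ)
    (I : Lp ℂ 2 (volume.restrict (Icc (0 : ℝ) ℓ)) →ₗ[ℂ] ℂ) :
    ¬ FiniteDimensional ℂ (LinearMap.ker I) := by
  intro h
  refine not_finiteDimensional hℓ ?_
  have h2 := Module.Finite.equiv (LinearMap.quotKerEquivRange I).symm
  exact Module.Finite.of_submodule_quotient (LinearMap.ker I)

end IntervalL2

/-! ### The form domain $H^1(\Gamma)$ and its compact embedding in $L^2(\Gamma)$. -/

namespace MetricGraph

open FormPencil
open scoped InnerProductSpace ComplexConjugate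

variable {V E : Type*} (G : MetricGraph V E)

/-- A vertex that is an end of no edge. -/
def IsIsolated (v : V) : Prop :=
  ∀ e, G.src e ≠ v ∧ G.tgt e ≠ v

/-- `L²` of an edge. -/
abbrev EdgeL2 (e : E) : Type := Lp ℂ 2 (volume.restrict (Icc (0 : ℝ) (G.len e)))

/-- The space `L²(Γ)`, as a type that does not unfold to a family of functions. -/
def L2Space : Type _ := G.L2

namespace L2Space

variable [Fintype E]

instance : NormedAddCommGroup G.L2Space := inferInstanceAs (NormedAddCommGroup (PiLp 2 G.EdgeL2))

instance : InnerProductSpace ℂ G.L2Space :=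
  inferInstanceAs (InnerProductSpace ℂ (PiLp 2 G.EdgeL2))

instance : CompleteSpace G.L2Space := inferInstanceAs (CompleteSpace (PiLp 2 G.EdgeL2))

/-- The identification with `L²(Γ)`. -/
def equivL2 : G.L2Space ≃ₗ[ℂ] G.L2 := LinearEquiv.refl ℂ G.L2

variable {G}

/-- The restriction to an edge. -/
def proj (e : E) : G.L2Space →L[ℂ] G.EdgeL2 e :=
  (PiLp.proj 2 G.EdgeL2 e : PiLp 2 G.EdgeL2 →L[ℂ] G.EdgeL2 e)

@[ext] lemma ext {x y : G.L2Space} (h : ∀ e, proj e x = proj e y) : x = y :=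
  PiLp.ext h

lemma inner_eq_sum (x y : G.L2Space) : ⟪x, y⟫_ℂ = ∑ e, ⟪proj e x, proj e y⟫_ℂ :=
  PiLp.inner_apply (f := G.EdgeL2) x y

lemma norm_sq_eq_sum (x : G.L2Space) : ‖x‖ ^ 2 = ∑ e, ‖proj e x‖ ^ 2 :=
  PiLp.norm_sq_eq_of_L2 G.EdgeL2 x

lemma norm_proj_le (x : G.L2Space) (e : E) : ‖proj e x‖ ≤ ‖x‖ :=
  PiLp.norm_apply_le (β := G.EdgeL2) x e

variable {X : Type*} [NormedAddCommGroup X] [NormedSpace ℂ X]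

/-- The map into `L²(Γ)` with given components. -/
def ofFamily (T : ∀ e, X →L[ℂ] G.EdgeL2 e) : X →L[ℂ] G.L2Space :=
  (((PiLp.continuousLinearEquiv 2 ℂ G.EdgeL2).symm : _ →L[ℂ] PiLp 2 G.EdgeL2) ∘L
    ContinuousLinearMap.pi T : X →L[ℂ] PiLp 2 G.EdgeL2)

@[simp] lemma proj_ofFamily (T : ∀ e, X →L[ℂ] G.EdgeL2 e) (x : X) (e : E) :
    proj e (ofFamily T x) = T e x := rfl

/-- Extension by zero from an edge. -/
def single [DecidableEq E] (e : E) : G.EdgeL2 e →L[ℂ] G.L2Space :=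
  ofFamily fun e' => ContinuousLinearMap.proj (R := ℂ) (φ := G.EdgeL2) e' ∘L
    ContinuousLinearMap.single ℂ G.EdgeL2 e

@[simp] lemma proj_single_same [DecidableEq E] (e : E) (x : G.EdgeL2 e) :
    proj e (single e x) = x :=
  Pi.single_eq_same (M := G.EdgeL2) e x

lemma proj_single_of_ne [DecidableEq E] {e e' : E} (h : e' ≠ e) (x : G.EdgeL2 e) :
    proj e' (single e x) = 0 :=
  Pi.single_eq_of_ne (M := G.EdgeL2) h x

lemma isCompactOperator_ofFamily {T : ∀ e, X →L[ℂ] G.EdgeL2 e}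
    (hT : ∀ e, IsCompactOperator (T e)) : IsCompactOperator (ofFamily T) := by
  classical
  have hsum : ofFamily T = ∑ e, single e ∘L T e := by
    ext1 x
    refine L2Space.ext fun e => ?_
    rw [sum_apply, map_sum, Finset.sum_eq_single e]
    · rw [ContinuousLinearMap.comp_apply, proj_single_same, proj_ofFamily]
    · intro e' _ he
      rw [ContinuousLinearMap.comp_apply, proj_single_of_ne he.symm]
    · exact fun h => absurd (Finset.mem_univ e) h
  rw [hsum]
  change _ ∈ compactOperator (RingHom.id ℂ) _ _
  exact Submodule.sum_mem _ fun e _ => (hT e).clm_comp (single e)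

end L2Space

section

variable [Fintype E]

/-- The defect of the compatibility of the vertex values with the derivative on an edge. -/
def edgeDefect (e : E) : WithLp 2 (EuclideanSpace ℂ V × G.L2Space) →L[ℂ] ℂ :=
  (EuclideanSpace.proj (G.tgt e) - EuclideanSpace.proj (G.src e)) ∘L WithLp.fstL 2 ℂ _ _ -
    IntervalL2.integralL (G.len e) 0 (G.len e) ∘L L2Space.proj e ∘L WithLp.sndL 2 ℂ _ _

/-- The form domain `H¹(Γ)`: a function on the graph is given by its vertex values and its
derivative on the edges. -/
def formDomain : Submodule ℂ (WithLp 2 (EuclideanSpace ℂ V × G.L2Space)) :=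
  (⨅ e, LinearMap.ker (G.edgeDefect e : _ →ₗ[ℂ] ℂ)) ⊓
    ⨅ v : {v // G.IsIsolated v}, LinearMap.ker
      ((EuclideanSpace.proj v.1 ∘L WithLp.fstL 2 ℂ (EuclideanSpace ℂ V) G.L2Space :) : _ →ₗ[ℂ] ℂ)

lemma mem_formDomain {w : WithLp 2 (EuclideanSpace ℂ V × G.L2Space)} :
    w ∈ G.formDomain ↔ (∀ e, w.fst (G.tgt e) =
      w.fst (G.src e) + ∫ t in (0 : ℝ)..G.len e, L2Space.proj e w.snd t) ∧
      ∀ v, G.IsIsolated v → w.fst v = 0 := by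
  simp only [formDomain, Submodule.mem_inf, Submodule.mem_iInf, LinearMap.mem_ker,
    ContinuousLinearMap.coe_coe, Subtype.forall]
  refine and_congr (forall_congr' fun e => ?_) Iff.rfl
  have : G.edgeDefect e w = w.fst (G.tgt e) - w.fst (G.src e) -
      IntervalL2.integralL (G.len e) 0 (G.len e) (L2Space.proj e w.snd) := rfl
  rw [this, IntervalL2.integralL_apply le_rfl (G.len_pos e).le le_rfl, sub_sub, sub_eq_zero]

lemma isClosed_formDomain :
    IsClosed (G.formDomain : Set (WithLp 2 (EuclideanSpace ℂ V × G.L2Space))) := by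
  rw [formDomain, Submodule.coe_inf, Submodule.coe_iInf, Submodule.coe_iInf]
  refine (isClosed_iInter fun e => ?_).inter (isClosed_iInter fun v => ?_)
  · exact ContinuousLinearMap.isClosed_ker (G.edgeDefect e)
  · exact ContinuousLinearMap.isClosed_ker
      (EuclideanSpace.proj v.1 ∘L WithLp.fstL 2 ℂ (EuclideanSpace ℂ V) G.L2Space)

/-- The form domain as a Hilbert space. -/
def FormSpace : Type _ := G.formDomain

end

namespace FormSpace

variable [Fintype V] [Fintype E]

instance : NormedAddCommGroup G.FormSpace := inferInstanceAs (NormedAddCommGroup G.formDomain)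

instance : InnerProductSpace ℂ G.FormSpace := inferInstanceAs (InnerProductSpace ℂ G.formDomain)

instance : CompleteSpace G.FormSpace := G.isClosed_formDomain.completeSpace_coe

variable {G}

/-- The inclusion in the space of pairs of vertex values and derivatives. -/
def toPair : G.FormSpace →L[ℂ] WithLp 2 (EuclideanSpace ℂ V × G.L2Space) := G.formDomain.subtypeL

/-- The value at a vertex. -/
def vertexValue (v : V) : G.FormSpace →L[ℂ] ℂ :=
  EuclideanSpace.proj v ∘L WithLp.fstL 2 ℂ _ _ ∘L toPair

/-- The derivative on the graph. -/
def deriv : G.FormSpace →L[ℂ] G.L2Space := WithLp.sndL 2 ℂ _ _ ∘L toPair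

/-- The derivative on an edge. -/
def edgeDeriv (e : E) : G.FormSpace →L[ℂ] G.EdgeL2 e := L2Space.proj e ∘L deriv

/-- The restriction to an edge. -/
def edgeEmbedding (e : E) : G.FormSpace →L[ℂ] G.EdgeL2 e :=
  Lp.constL 2 (volume.restrict (Icc (0 : ℝ) (G.len e))) ℂ ∘L vertexValue (G.src e) +
    IntervalL2.volterra (G.len_pos e) ∘L edgeDeriv e

/-- The embedding of the form domain in `L²(Γ)`. -/
def embedding : G.FormSpace →L[ℂ] G.L2Space := L2Space.ofFamily edgeEmbedding

/-- The derivative together with the embedding; its form is the `H¹` inner product. -/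
def sobolev : G.FormSpace →L[ℂ] WithLp 2 (G.L2Space × G.L2Space) :=
  ((WithLp.prodContinuousLinearEquiv 2 ℂ G.L2Space G.L2Space).symm :
    _ →L[ℂ] WithLp 2 (G.L2Space × G.L2Space)) ∘L deriv.prod embedding

/-- The values at the vertices of `R`. -/
def trace (R : Finset V) : G.FormSpace →L[ℂ] EuclideanSpace ℂ R :=
  ((PiLp.continuousLinearEquiv 2 ℂ (fun _ : R => ℂ)).symm :
    (R → ℂ) →L[ℂ] EuclideanSpace ℂ R) ∘L ContinuousLinearMap.pi fun v : R => vertexValue v.1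

/-- The continuous representative on an edge. -/
def edgeFun (w : G.FormSpace) (e : E) (x : ℝ) : ℂ :=
  vertexValue (G.src e) w + ∫ t in (0 : ℝ)..x, edgeDeriv e w t

/-- The element with given vertex values and derivatives. -/
def mk (φ : V → ℂ) (g : G.L2Space)
    (h : ∀ e, φ (G.tgt e) = φ (G.src e) + ∫ t in (0 : ℝ)..G.len e, L2Space.proj e g t)
    (h0 : ∀ v, G.IsIsolated v → φ v = 0) : G.FormSpace :=
  (⟨WithLp.toLp 2 (WithLp.toLp 2 φ, g), G.mem_formDomain.2 ⟨h, h0⟩⟩ : G.formDomain)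

section mk

variable {φ : V → ℂ} {g : G.L2Space}
    {h : ∀ e, φ (G.tgt e) = φ (G.src e) + ∫ t in (0 : ℝ)..G.len e, L2Space.proj e g t}
    {h0 : ∀ v, G.IsIsolated v → φ v = 0}

@[simp] lemma vertexValue_mk (v : V) : vertexValue v (mk φ g h h0) = φ v := rfl

@[simp] lemma edgeDeriv_mk (e : E) : edgeDeriv e (mk φ g h h0) = L2Space.proj e g := rfl

end mk

@[ext] lemma ext {w z : G.FormSpace} (h : ∀ v, vertexValue v w = vertexValue v z)
    (h' : ∀ e, edgeDeriv e w = edgeDeriv e z) : w = z := by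
  refine Subtype.ext ((WithLp.ofLp_injective 2) (Prod.ext ?_ ?_))
  · ext v
    exact h v
  · exact L2Space.ext h'

lemma norm_sq_eq (w : G.FormSpace) : ‖w‖ ^ 2 = ∑ v, ‖vertexValue v w‖ ^ 2 + ‖deriv w‖ ^ 2 := by
  have h1 : ‖w‖ ^ 2 = ‖(toPair w).fst‖ ^ 2 + ‖(toPair w).snd‖ ^ 2 :=
    WithLp.prod_norm_sq_eq_of_L2 (toPair w)
  rw [h1, EuclideanSpace.norm_sq_eq]
  rfl

lemma proj_embedding (w : G.FormSpace) (e : E) :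
    L2Space.proj e (embedding w) = edgeEmbedding e w := rfl

lemma vertexValue_tgt (w : G.FormSpace) (e : E) : vertexValue (G.tgt e) w =
    vertexValue (G.src e) w + ∫ t in (0 : ℝ)..G.len e, edgeDeriv e w t :=
  (G.mem_formDomain.1 w.2).1 e

lemma vertexValue_of_isIsolated (w : G.FormSpace) {v : V} (hv : G.IsIsolated v) :
    vertexValue v w = 0 :=
  (G.mem_formDomain.1 w.2).2 v hv

lemma coeFn_edgeEmbedding (w : G.FormSpace) (e : E) :
    edgeEmbedding e w =ᵐ[volume.restrict (Icc 0 (G.len e))] edgeFun w e := by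
  have h1 : edgeEmbedding e w = Lp.const 2 (volume.restrict (Icc (0 : ℝ) (G.len e)))
      (vertexValue (G.src e) w) + IntervalL2.volterra (G.len_pos e) (edgeDeriv e w) := rfl
  rw [h1]
  filter_upwards [Lp.coeFn_add (Lp.const 2 (volume.restrict (Icc (0 : ℝ) (G.len e)))
      (vertexValue (G.src e) w)) (IntervalL2.volterra (G.len_pos e) (edgeDeriv e w)),
    Lp.coeFn_const 2 (volume.restrict (Icc (0 : ℝ) (G.len e))) (vertexValue (G.src e) w),
    IntervalL2.coeFn_volterra (G.len_pos e) (edgeDeriv e w)] with x h2 h3 h4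
  rw [h2, Pi.add_apply, h3, h4]
  rfl

lemma edgeFun_zero (w : G.FormSpace) (e : E) : edgeFun w e 0 = vertexValue (G.src e) w := by
  simp [edgeFun]

lemma edgeFun_len (w : G.FormSpace) (e : E) :
    edgeFun w e (G.len e) = vertexValue (G.tgt e) w :=
  (vertexValue_tgt w e).symm

lemma edgeFun_eq_integral (w : G.FormSpace) (e : E) (x : ℝ) :
    edgeFun w e x = edgeFun w e 0 + ∫ t in (0 : ℝ)..x, edgeDeriv e w t := by
  rw [edgeFun_zero, edgeFun]

lemma continuousOn_edgeFun (w : G.FormSpace) (e : E) :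
    ContinuousOn (edgeFun w e) (Icc 0 (G.len e)) :=
  IsSobolevTwo.continuousOn_of_eq_integral (G.len_pos e) (IntervalL2.integrableOn _)
    fun x _ => edgeFun_eq_integral w e x

/-- If $u=0$ almost everywhere, its density vanishes, and by continuity so do its values at the ends
of edges. An isolated vertex is invisible in $L^2(\Gamma)$, which is why `formDomain` forces the
value 0 there. -/
lemma embedding_injective : Function.Injective (embedding (G := G)) := by
  rw [injective_iff_map_eq_zero]
  intro w hw
  have hJ : ∀ e, edgeFun w e =ᵐ[volume.restrict (Icc 0 (G.len e))] 0 := fun e => by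
    refine (coeFn_edgeEmbedding w e).symm.trans ?_
    rw [← proj_embedding, hw, map_zero]
    exact Lp.coeFn_zero _ _ _
  have hg : ∀ e, edgeDeriv e w = 0 := fun e => by
    have := IsSobolevTwo.density_ae_eq_zero (G.len_pos e) (IntervalL2.integrableOn _)
      (fun x _ => edgeFun_eq_integral w e x) (hJ e)
    exact Lp.ext (this.trans (Lp.coeFn_zero _ _ _).symm)
  have hEq : ∀ e, EqOn (edgeFun w e) 0 (Icc 0 (G.len e)) := fun e =>
    Measure.eqOn_Icc_of_ae_eq volume (G.len_pos e).ne (hJ e) (continuousOn_edgeFun w e)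
      continuousOn_const
  have hφ : ∀ v, vertexValue v w = 0 := fun v => by
    by_cases hv : G.IsIsolated v
    · exact vertexValue_of_isIsolated w hv
    simp only [IsIsolated, not_forall, not_and_or, not_not] at hv
    obtain ⟨e, rfl | rfl⟩ := hv
    · rw [← edgeFun_zero]
      exact hEq e (left_mem_Icc.2 (G.len_pos e).le)
    · rw [← edgeFun_len]
      exact hEq e (right_mem_Icc.2 (G.len_pos e).le)
  exact ext (by simpa using hφ) (by simpa using hg)

lemma isCompactOperator_embedding : IsCompactOperator (embedding (G := G)) := by
  refine L2Space.isCompactOperator_ofFamily fun e => ?_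
  have h1 : IsCompactOperator (vertexValue (G := G) (G.src e)) :=
    isCompactOperator_of_locallyCompactSpace_dom _
  exact (h1.clm_comp (Lp.constL 2 (volume.restrict (Icc (0 : ℝ) (G.len e))) ℂ)).add
    ((IntervalL2.isCompactOperator_volterra (G.len_pos e)).comp_clm (edgeDeriv e))

lemma norm_sq_sobolev (w : G.FormSpace) :
    ‖sobolev w‖ ^ 2 = ‖deriv w‖ ^ 2 + ‖embedding w‖ ^ 2 :=
  WithLp.prod_norm_sq_eq_of_L2 _

/-- With $T$ the Volterra operator, $u-Tu'$ is the constant function with value $u(0)$, whose norm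
is $\sqrt{\ell_e}\,|u(0)|$. The far end differs from it by $\int u'$. -/
lemma exists_vertexValue_bound (v : V) :
    ∃ C : ℝ, 0 ≤ C ∧ ∀ w : G.FormSpace, ‖vertexValue v w‖ ≤ C * ‖sobolev w‖ := by
  have hd : ∀ w : G.FormSpace, ‖deriv w‖ ≤ ‖sobolev w‖ := fun w =>
    abs_le_of_sq_le_sq' (by rw [norm_sq_sobolev]; exact le_add_of_nonneg_right (sq_nonneg _))
      (norm_nonneg _) |>.2
  have he : ∀ w : G.FormSpace, ‖embedding w‖ ≤ ‖sobolev w‖ := fun w =>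
    abs_le_of_sq_le_sq' (by rw [norm_sq_sobolev]; exact le_add_of_nonneg_left (sq_nonneg _))
      (norm_nonneg _) |>.2
  have hde : ∀ (w : G.FormSpace) e, ‖edgeDeriv e w‖ ≤ ‖sobolev w‖ := fun w e =>
    (L2Space.norm_proj_le (deriv w) e).trans (hd w)
  have hsrc : ∀ e, ∃ C : ℝ, 0 ≤ C ∧ ∀ w : G.FormSpace,
      ‖vertexValue (G.src e) w‖ ≤ C * ‖sobolev w‖ := fun e => by
    set T := IntervalL2.volterra (G.len_pos e)
    have hs : 0 < Real.sqrt (G.len e) := Real.sqrt_pos.2 (G.len_pos e)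
    refine ⟨(1 + ‖T‖) / Real.sqrt (G.len e), by positivity, fun w => ?_⟩
    set c := Lp.const 2 (volume.restrict (Icc (0 : ℝ) (G.len e))) (vertexValue (G.src e) w)
    have h1 : c = edgeEmbedding e w - T (edgeDeriv e w) := by
      rw [eq_sub_iff_add_eq]
      rfl
    have h2 : ‖c‖ = Real.sqrt (G.len e) * ‖vertexValue (G.src e) w‖ := by
      rw [← Real.sqrt_sq (norm_nonneg c), IntervalL2.norm_sq_const (G.len_pos e)
        (Lp.coeFn_const _ _ _), Real.sqrt_mul (G.len_pos e).le, Real.sqrt_sq (norm_nonneg _)]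
    have h3 : ‖c‖ ≤ (1 + ‖T‖) * ‖sobolev w‖ := by
      rw [h1]
      calc _ ≤ ‖edgeEmbedding e w‖ + ‖T (edgeDeriv e w)‖ := norm_sub_le _ _
        _ ≤ ‖sobolev w‖ + ‖T‖ * ‖sobolev w‖ := by
          gcongr
          · exact (L2Space.norm_proj_le (embedding w) e).trans (he w)
          · exact (T.le_opNorm _).trans (by gcongr; exact hde w e)
        _ = _ := by ring
    rw [div_mul_eq_mul_div, le_div_iff₀ hs, mul_comm, ← h2]
    exact h3
  by_cases hv : G.IsIsolated v
  · exact ⟨0, le_rfl, fun w => by rw [vertexValue_of_isIsolated w hv]; simp⟩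
  simp only [IsIsolated, not_forall, not_and_or, not_not] at hv
  obtain ⟨e, rfl | rfl⟩ := hv
  · exact hsrc e
  obtain ⟨C, hC0, hC⟩ := hsrc e
  refine ⟨C + Real.sqrt (G.len e), by positivity, fun w => ?_⟩
  rw [vertexValue_tgt, add_mul]
  refine (norm_add_le _ _).trans (add_le_add (hC w) ?_)
  refine (IntervalL2.norm_integral_le le_rfl (G.len_pos e).le le_rfl _).trans ?_
  rw [sub_zero]
  gcongr
  exact hde w e

lemma exists_antilipschitz_sobolev :
    ∃ C : NNReal, AntilipschitzWith C (sobolev (G := G)) := by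
  choose C hC0 hC using exists_vertexValue_bound (G := G)
  refine ⟨(Real.sqrt (∑ v, C v ^ 2 + 1)).toNNReal,
    ContinuousLinearMap.antilipschitz_of_bound _ fun w => ?_⟩
  have h2 : ‖w‖ ^ 2 ≤ (∑ v, C v ^ 2 + 1) * ‖sobolev w‖ ^ 2 := by
    rw [norm_sq_eq, add_mul, Finset.sum_mul, one_mul]
    gcongr with v
    · rw [← mul_pow]
      gcongr
      exact hC v w
    · rw [← sq_le_sq₀ (norm_nonneg _) (norm_nonneg _), norm_sq_sobolev]
      exact le_add_of_nonneg_right (sq_nonneg _)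
  refine abs_le_of_sq_le_sq' ?_ (by positivity) |>.2
  rw [mul_pow, Real.coe_toNNReal _ (Real.sqrt_nonneg _), Real.sq_sqrt (by positivity)]
  exact h2

/-- Every derivative on a single edge with integral zero comes from a function vanishing at all
vertices, and such derivatives form the kernel of one functional on an infinite-dimensional space.
-/
lemma not_finiteDimensional [Nonempty E] : ¬ FiniteDimensional ℂ G.FormSpace := by
  classical
  intro hfin
  obtain ⟨e⟩ := ‹Nonempty E›
  set N : Submodule ℂ (G.EdgeL2 e) :=
    LinearMap.ker (IntervalL2.integralL (G.len e) 0 (G.len e) : _ →ₗ[ℂ] ℂ) with hN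
  have hmk : ∀ (h : N) e', (0 : ℂ) =
      0 + ∫ t in (0 : ℝ)..G.len e', L2Space.proj e' (L2Space.single e h.1) t := by
    intro h e'
    rw [← IntervalL2.integralL_apply le_rfl (G.len_pos e').le le_rfl, zero_add]
    by_cases he : e' = e
    · subst he
      rw [L2Space.proj_single_same]
      exact h.2.symm
    · rw [L2Space.proj_single_of_ne he, map_zero]
  let T : N →ₗ[ℂ] G.FormSpace :=
    { toFun := fun h => mk 0 (L2Space.single e h.1) (hmk h) (fun _ _ => rfl)
      map_add' := fun a b => by
        refine ext (fun v => ?_) fun e' => ?_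
        · rw [map_add, vertexValue_mk, vertexValue_mk, vertexValue_mk, Pi.zero_apply, add_zero]
        · rw [map_add, edgeDeriv_mk, edgeDeriv_mk, edgeDeriv_mk, Submodule.coe_add, map_add,
            map_add]
      map_smul' := fun c a => by
        refine ext (fun v => ?_) fun e' => ?_
        · rw [map_smul, vertexValue_mk, vertexValue_mk, Pi.zero_apply, smul_zero]
        · rw [map_smul, edgeDeriv_mk, edgeDeriv_mk, Submodule.coe_smul, map_smul, map_smul,
            RingHom.id_apply] }
  have hT : Function.Injective T := fun a b hab => by
    have h1 := congrArg (edgeDeriv e) hab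
    have h2 : ∀ a, edgeDeriv e (T a) = a.1 := fun a => L2Space.proj_single_same e a.1
    rw [h2, h2] at h1
    exact Subtype.ext h1
  exact IntervalL2.not_finiteDimensional_ker (G.len_pos e) _ (Module.Finite.of_injective T hT)

lemma isDiscrete [Nonempty E] : IsDiscrete (sobolev (G := G)) embedding where
  antilipschitz := exists_antilipschitz_sobolev
  compact := isCompactOperator_embedding
  injective := embedding_injective
  infinite := not_finiteDimensional

end FormSpace

end MetricGraph
end

/-! ### Weak eigenfunctions are the eigenfunctions of $H^{(\sigma)}$. -/

noncomputable section

namespace MetricGraph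

open FormPencil
open scoped InnerProductSpace ComplexConjugate

variable {V E : Type*} [Fintype E] {G : MetricGraph V E}

/-- The element of `L²(Γ)` with given restrictions to the edges. -/
def L2Space.ofEdges (g : ∀ e, G.EdgeL2 e) : G.L2Space := WithLp.toLp 2 g

@[simp] lemma L2Space.proj_ofEdges (g : ∀ e, G.EdgeL2 e) (e : E) :
    L2Space.proj e (L2Space.ofEdges g) = g e := rfl

lemma outwardFlux_of_isIsolated [DecidableEq V] {v : V} (hv : G.IsIsolated v) (u' : E → ℝ → ℂ) :
    G.outwardFlux u' v = 0 := by
  rw [outwardFlux, Finset.filter_false_of_mem fun e _ => (hv e).1,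
    Finset.filter_false_of_mem fun e _ => (hv e).2]
  simp

namespace FormSpace

variable [Fintype V]

lemma inner_sobolev (w z : G.FormSpace) : ⟪sobolev w, sobolev z⟫_ℂ =
    ∑ e, ⟪edgeDeriv e w, edgeDeriv e z⟫_ℂ + ∑ e, ⟪edgeEmbedding e w, edgeEmbedding e z⟫_ℂ := by
  rw [WithLp.prod_inner_apply]
  change ⟪deriv w, deriv z⟫_ℂ + ⟪embedding w, embedding z⟫_ℂ = _
  rw [L2Space.inner_eq_sum, L2Space.inner_eq_sum]
  rfl

lemma inner_embedding (w z : G.FormSpace) : ⟪embedding w, embedding z⟫_ℂ =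
    ∑ e, ⟪edgeEmbedding e w, edgeEmbedding e z⟫_ℂ := by
  rw [L2Space.inner_eq_sum]
  rfl

lemma inner_trace (R : Finset V) (w z : G.FormSpace) : ⟪trace R w, trace R z⟫_ℂ =
    ∑ v ∈ R, conj (vertexValue v w) * vertexValue v z := by
  rw [PiLp.inner_apply, ← Finset.sum_coe_sort R]
  refine Finset.sum_congr rfl fun v _ => ?_
  rw [RCLike.inner_apply, mul_comm]
  rfl

/-- The eigenspace of `H^(σ)` in the sense of quadratic forms. -/
def weakEigenspace (G : MetricGraph V E) (R : Finset V) (σ μ : ℝ) : Submodule ℂ G.FormSpace :=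
  FormPencil.eigenspace (perturb (sobolev (G := G)) (trace (G := G) R) σ)
    (embedding (G := G)) (μ + 1)

/-- The $L^2$ term of the Sobolev form cancels the shift of `μ` by 1. -/
lemma mem_weakEigenspace {R : Finset V} {σ μ : ℝ} (hσ : 0 ≤ σ) {w : G.FormSpace} :
    w ∈ weakEigenspace G R σ μ ↔ ∀ z : G.FormSpace, ∑ e, ⟪edgeDeriv e w, edgeDeriv e z⟫_ℂ +
      σ * ∑ v ∈ R, conj (vertexValue v w) * vertexValue v z =
      μ * ∑ e, ⟪edgeEmbedding e w, edgeEmbedding e z⟫_ℂ := by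
  refine forall_congr' fun z => ?_
  rw [inner_perturb hσ, inner_sobolev, inner_trace, inner_embedding]
  push_cast
  constructor <;> intro h <;> linear_combination h

lemma edgeEmbedding_eq_zero {w : G.FormSpace} {e : E} (h1 : vertexValue (G.src e) w = 0)
    (h2 : edgeDeriv e w = 0) : edgeEmbedding e w = 0 := by
  have : edgeEmbedding e w = Lp.constL 2 (volume.restrict (Icc (0 : ℝ) (G.len e))) ℂ
      (vertexValue (G.src e) w) + IntervalL2.volterra (G.len_pos e) (edgeDeriv e w) := rfl
  rw [this, h1, h2, map_zero, map_zero, add_zero]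

/-- Weak solutions of the eigenvalue equation are twice weakly differentiable on the edges. -/
lemma exists_deriv_eq_of_weak {w : G.FormSpace} {e : E} {μ : ℝ}
    (hw : ∀ z : G.FormSpace, (∀ v, vertexValue v z = 0) → (∀ e' ≠ e, edgeDeriv e' z = 0) →
      ⟪edgeDeriv e w, edgeDeriv e z⟫_ℂ = μ * ⟪edgeEmbedding e w, edgeEmbedding e z⟫_ℂ) :
    ∃ c : ℂ, edgeDeriv e w =ᵐ[volume.restrict (Icc 0 (G.len e))]
      fun x => c + ∫ t in (0 : ℝ)..x, -(μ : ℂ) * edgeFun w e t := by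
  classical
  have hcont := continuousOn_edgeFun w e
  have hint : IntegrableOn (edgeFun w e) (Icc 0 (G.len e)) := hcont.integrableOn_Icc
  have hU := IntervalL2.continuousOn_primitive (G.len_pos e) hint
  set U : G.EdgeL2 e := (IntervalL2.memLp_of_continuousOn hU).toLp _ with hUdef
  have hUae := MemLp.coeFn_toLp (IntervalL2.memLp_of_continuousOn hU)
  set a : G.EdgeL2 e := indicatorConstLp 2 (measurableSet_Ioc (a := (0 : ℝ)) (b := G.len e))
    (measure_ne_top _ _) (1 : ℂ) with ha
  have hI : ∀ h : G.EdgeL2 e, ⟪a, h⟫_ℂ = ∫ t in (0 : ℝ)..G.len e, h t := fun h =>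
    IntervalL2.integralL_apply le_rfl (G.len_pos e).le le_rfl h
  -- The du Bois-Reymond argument: $u'+\mu\int u$ is orthogonal to every `h` of integral zero,
  -- because such an `h` is the derivative of a test function vanishing at the vertices. Hence it is
  -- a multiple of the constant function `a`.
  have hmem : edgeDeriv e w + (μ : ℂ) • U ∈ (ℂ ∙ a)ᗮᗮ := by
    intro h hh
    rw [Submodule.mem_orthogonal_singleton_iff_inner_right, hI] at hh
    rw [← inner_conj_symm, map_eq_zero]
    have hmk : ∀ e', (0 : V → ℂ) (G.tgt e') = (0 : V → ℂ) (G.src e') +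
        ∫ t in (0 : ℝ)..G.len e', L2Space.proj e' (L2Space.single e h) t := by
      intro e'
      rw [← IntervalL2.integralL_apply le_rfl (G.len_pos e').le le_rfl]
      by_cases he : e' = e
      · subst he
        rw [L2Space.proj_single_same, IntervalL2.integralL_apply le_rfl (G.len_pos e').le le_rfl,
          hh]
        simp
      · rw [L2Space.proj_single_of_ne he, map_zero]
        simp
    set z : G.FormSpace := mk 0 (L2Space.single e h) hmk (fun _ _ => rfl) with hz
    have hzd : edgeDeriv e z = h := by rw [hz, edgeDeriv_mk, L2Space.proj_single_same]
    have h1 := hw z (fun v => rfl) fun e' he => by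
      rw [hz, edgeDeriv_mk, L2Space.proj_single_of_ne he]
    have hparts := IntervalL2.integral_conj_mul_add (G.len_pos e) hint
      (IntervalL2.integrableOn (edgeDeriv e z))
      (A := fun x => ∫ t in (0 : ℝ)..x, edgeFun w e t) (fun x _ => by simp)
      (fun x _ => edgeFun_eq_integral z e x)
    rw [← IntervalL2.inner_eq_integral _ _ (coeFn_edgeEmbedding w e) (coeFn_edgeEmbedding z e),
      ← IntervalL2.inner_eq_integral U (edgeDeriv e z) hUae Filter.EventuallyEq.rfl, edgeFun_len,
      edgeFun_zero] at hparts
    have hz0 : ∀ v, vertexValue v z = 0 := fun v => rfl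
    rw [hz0, hz0, mul_zero, mul_zero, sub_zero, hzd] at hparts
    rw [hzd] at h1
    rw [inner_add_left, inner_smul_left, h1, Complex.conj_ofReal]
    linear_combination (μ : ℂ) * hparts
  rw [Submodule.orthogonal_orthogonal, Submodule.mem_span_singleton] at hmem
  obtain ⟨c, hc⟩ := hmem
  refine ⟨c, ?_⟩
  have hg : edgeDeriv e w = c • a - (μ : ℂ) • U := by rw [hc, add_sub_cancel_right]
  have hIoc : ∀ᵐ x ∂volume.restrict (Icc 0 (G.len e)), x ∈ Ioc 0 (G.len e) := by
    rw [← restrict_Ioc_eq_restrict_Icc]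
    exact ae_restrict_mem measurableSet_Ioc
  have haae := indicatorConstLp_coeFn (p := 2) (μ := volume.restrict (Icc 0 (G.len e)))
    (hs := measurableSet_Ioc (a := (0 : ℝ)) (b := G.len e)) (hμs := measure_ne_top _ _)
    (c := (1 : ℂ))
  rw [hg]
  filter_upwards [hIoc, haae, hUae, Lp.coeFn_sub (c • a) ((μ : ℂ) • U), Lp.coeFn_smul c a,
    Lp.coeFn_smul (μ : ℂ) U] with x h1 h2 h3 h4 h5 h6
  rw [h4, Pi.sub_apply, h5, h6, Pi.smul_apply, Pi.smul_apply, hUdef, h3, ha, h2,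
    indicator_of_mem h1, intervalIntegral.integral_const_mul]
  simp only [smul_eq_mul]
  ring

section Green

variable [DecidableEq V]

/-- Green's formula. -/
lemma green {w z : G.FormSpace} {μ : ℝ} {u' : E → ℝ → ℂ}
    (h1 : ∀ e, edgeDeriv e w =ᵐ[volume.restrict (Icc 0 (G.len e))] u' e)
    (h2 : ∀ e, ∀ x ∈ Icc (0 : ℝ) (G.len e),
      u' e x = u' e 0 + ∫ t in (0 : ℝ)..x, -(μ : ℂ) * edgeFun w e t) :
    ∑ e, ⟪edgeDeriv e w, edgeDeriv e z⟫_ℂ = μ * ∑ e, ⟪edgeEmbedding e w, edgeEmbedding e z⟫_ℂ -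
      ∑ v, conj (G.outwardFlux u' v) * vertexValue v z := by
  have hedge : ∀ e, ⟪edgeDeriv e w, edgeDeriv e z⟫_ℂ =
      μ * ⟪edgeEmbedding e w, edgeEmbedding e z⟫_ℂ +
      (conj (u' e (G.len e)) * vertexValue (G.tgt e) z -
        conj (u' e 0) * vertexValue (G.src e) z) := by
    intro e
    have hint : IntegrableOn (fun t => -(μ : ℂ) * edgeFun w e t) (Icc 0 (G.len e)) :=
      (continuousOn_const.mul (continuousOn_edgeFun w e)).integrableOn_Icc
    have hparts := IntervalL2.integral_conj_mul_add (G.len_pos e) hint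
      (IntervalL2.integrableOn (edgeDeriv e z)) (h2 e) (fun x _ => edgeFun_eq_integral z e x)
    rw [← IntervalL2.inner_eq_integral _ _ (h1 e) Filter.EventuallyEq.rfl, edgeFun_len,
      edgeFun_zero] at hparts
    have h3 : ∫ x in Icc 0 (G.len e), conj (-(μ : ℂ) * edgeFun w e x) * edgeFun z e x =
        -(μ : ℂ) * ⟪edgeEmbedding e w, edgeEmbedding e z⟫_ℂ := by
      rw [IntervalL2.inner_eq_integral _ _ (coeFn_edgeEmbedding w e) (coeFn_edgeEmbedding z e),
        ← integral_const_mul]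
      congr 1
      ext x
      rw [map_mul, map_neg, Complex.conj_ofReal]
      ring
    rw [h3] at hparts
    linear_combination hparts
  have hsrc : ∑ v, (∑ e with G.src e = v, conj (u' e 0)) * vertexValue v z =
      ∑ e, conj (u' e 0) * vertexValue (G.src e) z := by
    rw [← Finset.sum_fiberwise Finset.univ G.src]
    refine Finset.sum_congr rfl fun v _ => ?_
    rw [Finset.sum_mul]
    refine Finset.sum_congr rfl fun e he => ?_
    rw [(Finset.mem_filter.1 he).2]
  have htgt : ∑ v, (∑ e with G.tgt e = v, conj (u' e (G.len e))) * vertexValue v z =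
      ∑ e, conj (u' e (G.len e)) * vertexValue (G.tgt e) z := by
    rw [← Finset.sum_fiberwise Finset.univ G.tgt]
    refine Finset.sum_congr rfl fun v _ => ?_
    rw [Finset.sum_mul]
    refine Finset.sum_congr rfl fun e he => ?_
    rw [(Finset.mem_filter.1 he).2]
  rw [Finset.sum_congr rfl fun e _ => hedge e, Finset.sum_add_distrib, ← Finset.mul_sum,
    Finset.sum_sub_distrib, ← hsrc, ← htgt]
  simp only [outwardFlux, map_sub, map_sum, sub_mul, Finset.sum_sub_distrib]
  ring

/-- Regularity of weak eigenfunctions. -/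
lemma exists_deriv_of_mem_weakEigenspace {R : Finset V} {σ μ : ℝ} (hσ : 0 ≤ σ) {w : G.FormSpace}
    (hw : w ∈ weakEigenspace G R σ μ) :
    ∃ u' : E → ℝ → ℂ, (∀ e, edgeDeriv e w =ᵐ[volume.restrict (Icc 0 (G.len e))] u' e) ∧
      (∀ e, ∀ x ∈ Icc (0 : ℝ) (G.len e),
        u' e x = u' e 0 + ∫ t in (0 : ℝ)..x, -(μ : ℂ) * edgeFun w e t) ∧
      ∀ v, G.outwardFlux u' v = if v ∈ R then (σ : ℂ) * vertexValue v w else 0 := by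
  rw [mem_weakEigenspace hσ] at hw
  have hreg : ∀ e, ∃ c : ℂ, edgeDeriv e w =ᵐ[volume.restrict (Icc 0 (G.len e))]
      fun x => c + ∫ t in (0 : ℝ)..x, -(μ : ℂ) * edgeFun w e t := fun e => by
    refine exists_deriv_eq_of_weak fun z hz hz' => ?_
    have h := hw z
    rw [Finset.sum_eq_single e (fun e' _ he => by rw [hz' e' he, inner_zero_right])
        (fun h => absurd (Finset.mem_univ e) h),
      Finset.sum_eq_zero (fun v _ => by rw [hz v, mul_zero]),
      Finset.sum_eq_single e (fun e' _ he => by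
        rw [edgeEmbedding_eq_zero (hz _) (hz' e' he), inner_zero_right])
        (fun h => absurd (Finset.mem_univ e) h), mul_zero, add_zero] at h
    exact h
  choose c hc using hreg
  set u' : E → ℝ → ℂ := fun e x => c e + ∫ t in (0 : ℝ)..x, -(μ : ℂ) * edgeFun w e t with hu'
  have h2 : ∀ e, ∀ x ∈ Icc (0 : ℝ) (G.len e),
      u' e x = u' e 0 + ∫ t in (0 : ℝ)..x, -(μ : ℂ) * edgeFun w e t := fun e x _ => by
    simp [hu']
  refine ⟨u', hc, h2, fun v => ?_⟩
  by_cases hv : G.IsIsolated v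
  · rw [outwardFlux_of_isIsolated hv, vertexValue_of_isIsolated w hv]
    simp
  set ψ : V → ℂ := Pi.single v 1 with hψ
  -- The test function with value 1 at `v` and 0 at the other vertices, affine on every edge; in
  -- Green's formula it isolates the flux at `v`.
  set z : G.FormSpace := mk ψ (L2Space.ofEdges fun e =>
      Lp.const 2 (volume.restrict (Icc (0 : ℝ) (G.len e)))
        ((ψ (G.tgt e) - ψ (G.src e)) / (G.len e : ℂ))) (fun e => by
      have hl : (G.len e : ℂ) ≠ 0 := by exact_mod_cast (G.len_pos e).ne'
      rw [L2Space.proj_ofEdges, IntervalL2.integral_congr_ae_Icc (Lp.coeFn_const 2 _ _)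
        (right_mem_Icc.2 (G.len_pos e).le)]
      simp only [Function.const_apply, intervalIntegral.integral_const, sub_zero,
        Complex.real_smul]
      field_simp
      ring) (fun v' hv' => Pi.single_eq_of_ne (by rintro rfl; exact hv hv') _) with hz
  have h3 := hw z
  rw [green hc h2] at h3
  have hzv : ∀ v', vertexValue v' z = ψ v' := fun v' => rfl
  simp only [hzv, hψ, Pi.single_apply, mul_ite, mul_one, mul_zero, Finset.sum_ite_eq',
    Finset.mem_univ, if_true] at h3
  have h4 : conj (G.outwardFlux u' v) = if v ∈ R then (σ : ℂ) * conj (vertexValue v w) else 0 := by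
    split_ifs at h3 ⊢ <;> linear_combination -h3
  have h5 := congrArg conj h4
  rw [Complex.conj_conj] at h5
  rw [h5]
  split_ifs <;> simp

/-- The eigenspaces of `H^(σ)` are the eigenspaces in the sense of quadratic forms. -/
lemma map_weakEigenspace {R : Finset V} {σ : ℝ} (hσ : 0 ≤ σ) (μ : ℝ) :
    (weakEigenspace G R σ μ).map ((L2Space.equivL2 G).toLinearMap ∘ₗ
      (embedding : G.FormSpace →L[ℂ] G.L2Space).toLinearMap) = G.robinEigenspace R σ μ := by
  ext f
  rw [robinEigenspace, robinLaplacian_graph, Submodule.mem_comap, Submodule.mem_map]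
  constructor
  · rintro ⟨w, hw, rfl⟩
    obtain ⟨u', h1, h2, h3⟩ := exists_deriv_of_mem_weakEigenspace hσ hw
    have hae : ∀ e, ((L2Space.equivL2 G (embedding w)) e : ℝ → ℂ)
        =ᵐ[volume.restrict (Icc 0 (G.len e))] edgeFun w e := fun e => coeFn_edgeEmbedding w e
    refine ⟨fun e => edgeFun w e, u', fun e t => -(μ : ℂ) * edgeFun w e t,
      fun v => vertexValue v w, fun e => ⟨?_, fun x hx => ?_, h2 e⟩, hae, fun e => ?_,
      fun e => ⟨edgeFun_zero w e, edgeFun_len w e⟩, h3⟩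
    · exact IntervalL2.memLp_of_continuousOn (continuousOn_const.mul (continuousOn_edgeFun w e))
    · refine (edgeFun_eq_integral w e x).trans ?_
      rw [IntervalL2.integral_congr_ae_Icc (h1 e) hx]
    · refine (Lp.coeFn_smul (μ : ℂ) ((L2Space.equivL2 G (embedding w)) e)).trans ?_
      filter_upwards [hae e] with x hx
      simp [hx]
  · rintro ⟨u, u', u'', φ, h1, h2, h3, h4, h5⟩
    classical
    have hcont : ∀ e, ContinuousOn (u' e) (Icc 0 (G.len e)) := fun e =>
      IsSobolevTwo.continuousOn_of_eq_integral (G.len_pos e) (h1 e).integrableOn_snd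
        (h1 e).deriv_eq_integral
    set g : ∀ e, G.EdgeL2 e := fun e => (IntervalL2.memLp_of_continuousOn (hcont e)).toLp _
    have hg : ∀ e, g e =ᵐ[volume.restrict (Icc 0 (G.len e))] u' e := fun e =>
      MemLp.coeFn_toLp (IntervalL2.memLp_of_continuousOn (hcont e))
    -- `robinGraph` does not fix the function `φ` at isolated vertices in general; resetting these
    -- values to 0 changes nothing on the edges.
    set φ₀ : V → ℂ := fun v => if G.IsIsolated v then 0 else φ v with hφ₀
    have hsrc : ∀ e, φ₀ (G.src e) = φ (G.src e) := fun e =>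
      if_neg fun h => (h e).1 rfl
    have htgt : ∀ e, φ₀ (G.tgt e) = φ (G.tgt e) := fun e =>
      if_neg fun h => (h e).2 rfl
    have hmk : ∀ e, φ₀ (G.tgt e) = φ₀ (G.src e) +
        ∫ t in (0 : ℝ)..G.len e, L2Space.proj e (L2Space.ofEdges g) t := fun e => by
      rw [L2Space.proj_ofEdges, IntervalL2.integral_congr_ae_Icc (hg e)
        (right_mem_Icc.2 (G.len_pos e).le), hsrc, htgt, ← (h4 e).1, ← (h4 e).2]
      exact (h1 e).eq_integral _ (right_mem_Icc.2 (G.len_pos e).le)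
    set w : G.FormSpace := mk φ₀ (L2Space.ofEdges g) hmk fun v hv => if_pos hv with hw
    have hd : ∀ e, edgeDeriv e w = g e := fun e => rfl
    have hfun : ∀ e, ∀ x ∈ Icc (0 : ℝ) (G.len e), edgeFun w e x = u e x := fun e x hx => by
      rw [edgeFun, hd, IntervalL2.integral_congr_ae_Icc (hg e) hx, hw, vertexValue_mk, hsrc,
        ← (h4 e).1, ← (h1 e).eq_integral x hx]
    have hfun' : ∀ e, edgeFun w e =ᵐ[volume.restrict (Icc 0 (G.len e))] u e := fun e =>
      (ae_restrict_iff' measurableSet_Icc).2 (ae_of_all _ (hfun e))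
    have hemb : L2Space.equivL2 G (embedding w) = f := by
      refine PiLp.ext fun e => Lp.ext ?_
      exact (coeFn_edgeEmbedding w e).trans ((hfun' e).trans (h2 e).symm)
    have hsnd : ∀ e, u'' e =ᵐ[volume.restrict (Icc 0 (G.len e))]
        fun t => -(μ : ℂ) * edgeFun w e t := fun e => by
      have h6 : (((μ : ℂ) • f) e : ℝ → ℂ) =ᵐ[volume.restrict (Icc 0 (G.len e))] -u'' e := h3 e
      filter_upwards [h6, Lp.coeFn_smul (μ : ℂ) (f e), h2 e, hfun' e] with x h7 h8 h9 h10
      have h11 : (((μ : ℂ) • f) e : ℝ → ℂ) x = (μ : ℂ) * u e x := by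
        refine h8.trans ?_
        rw [Pi.smul_apply, smul_eq_mul]
        exact congrArg _ h9
      rw [h11, Pi.neg_apply] at h7
      rw [h10]
      linear_combination h7
    have hderiv : ∀ e, ∀ x ∈ Icc (0 : ℝ) (G.len e),
        u' e x = u' e 0 + ∫ t in (0 : ℝ)..x, -(μ : ℂ) * edgeFun w e t := fun e x hx => by
      rw [← IntervalL2.integral_congr_ae_Icc (hsnd e) hx]
      exact (h1 e).deriv_eq_integral x hx
    refine ⟨w, ?_, hemb⟩
    rw [mem_weakEigenspace hσ]
    intro z
    rw [green hg hderiv]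
    have hflux : ∑ v, conj (G.outwardFlux u' v) * vertexValue v z =
        σ * ∑ v ∈ R, conj (vertexValue v w) * vertexValue v z := by
      rw [Finset.mul_sum, ← Finset.sum_subset (Finset.subset_univ R)]
      · refine Finset.sum_congr rfl fun v hv => ?_
        by_cases hi : G.IsIsolated v
        · rw [vertexValue_of_isIsolated z hi]
          simp
        · have : vertexValue v w = φ v := if_neg hi
          rw [h5, if_pos hv, this, map_mul, Complex.conj_ofReal, mul_assoc]
      · intro v _ hv
        rw [h5, if_neg hv]
        simp
    rw [hflux]
    ring

end Green

end FormSpace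

end MetricGraph
end

/-! ### Energy on an edge, the trace estimate and the gap bounds. -/

noncomputable section

namespace IntervalL2

open scoped ComplexConjugate

/-- Conservation of energy for solutions of `-u'' = μ u`. -/
lemma energy_eq {ℓ μ : ℝ} {u u' : ℝ → ℂ} (hu : ContinuousOn u (Icc 0 ℓ))
    (hu' : ContinuousOn u' (Icc 0 ℓ))
    (h1 : ∀ x ∈ Icc (0 : ℝ) ℓ, u x = u 0 + ∫ t in (0 : ℝ)..x, u' t)
    (h2 : ∀ x ∈ Icc (0 : ℝ) ℓ, u' x = u' 0 + ∫ t in (0 : ℝ)..x, -(μ : ℂ) * u t)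
    {x : ℝ} (hx : x ∈ Icc (0 : ℝ) ℓ) :
    ‖u' x‖ ^ 2 + μ * ‖u x‖ ^ 2 = ‖u' 0‖ ^ 2 + μ * ‖u 0‖ ^ 2 := by
  rcases eq_or_lt_of_le hx.1 with rfl | hx0
  · rfl
  have hsub : Icc 0 x ⊆ Icc 0 ℓ := Icc_subset_Icc_right hx.2
  have hi : IntegrableOn (fun t => -(μ : ℂ) * u t) (Icc 0 x) :=
    (continuousOn_const.mul (hu.mono hsub)).integrableOn_Icc
  have hi' : IntegrableOn u' (Icc 0 x) := (hu'.mono hsub).integrableOn_Icc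
  -- `hp` and `hq` express the increments of $|u'|^2$ and $|u|^2$; in `hp` plus $\mu$ times `hq` the
  -- integrals cancel.
  have hp := integral_conj_mul_add hx0 hi hi (fun y hy => h2 y (hsub hy))
    (fun y hy => h2 y (hsub hy))
  have hq := integral_conj_mul_add hx0 hi' hi' (fun y hy => h1 y (hsub hy))
    (fun y hy => h1 y (hsub hy))
  have e1 : ∫ t in Icc 0 x, conj (-(μ : ℂ) * u t) * u' t =
      -(μ : ℂ) * ∫ t in Icc 0 x, conj (u t) * u' t := by
    rw [← integral_const_mul]
    congr 1
    ext t
    rw [map_mul, map_neg, Complex.conj_ofReal, mul_assoc]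
  have e2 : ∫ t in Icc 0 x, conj (u' t) * (-(μ : ℂ) * u t) =
      -(μ : ℂ) * ∫ t in Icc 0 x, conj (u' t) * u t := by
    rw [← integral_const_mul]
    congr 1
    ext t
    ring
  rw [e1, e2] at hp
  simp only [Complex.conj_mul'] at hp hq
  have : ((‖u' x‖ ^ 2 + μ * ‖u x‖ ^ 2 : ℝ) : ℂ) = ((‖u' 0‖ ^ 2 + μ * ‖u 0‖ ^ 2 : ℝ) : ℂ) := by
    push_cast
    linear_combination -hp - (μ : ℂ) * hq
  exact_mod_cast this

end IntervalL2

namespace MetricGraph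

open FormPencil
open scoped InnerProductSpace ComplexConjugate

variable {V E : Type*} [Fintype E] {G : MetricGraph V E}

namespace FormSpace

variable [Fintype V]

lemma norm_sq_trace (R : Finset V) (w : G.FormSpace) :
    ‖trace R w‖ ^ 2 = ∑ v ∈ R, ‖vertexValue v w‖ ^ 2 := by
  rw [EuclideanSpace.norm_sq_eq, ← Finset.sum_coe_sort R]
  rfl

lemma norm_sq_embedding (w : G.FormSpace) :
    ‖embedding w‖ ^ 2 = ∑ e, ‖edgeEmbedding e w‖ ^ 2 :=
  L2Space.norm_sq_eq_sum _

lemma norm_sq_deriv (w : G.FormSpace) : ‖deriv w‖ ^ 2 = ∑ e, ‖edgeDeriv e w‖ ^ 2 :=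
  L2Space.norm_sq_eq_sum _

/-- The weak equation tested with `w` itself. -/
lemma energy_identity {R : Finset V} {σ μ : ℝ} (hσ : 0 ≤ σ) {w : G.FormSpace}
    (hw : w ∈ weakEigenspace G R σ μ) :
    ‖deriv w‖ ^ 2 + σ * ‖trace R w‖ ^ 2 = μ * ‖embedding w‖ ^ 2 := by
  have h := norm_sq_of_mem_eigenspace hw
  rw [norm_sq_perturb hσ, norm_sq_sobolev] at h
  linarith

/-- The `n`-th eigenvalue of the pencil of `H^(σ)`, that is, the `n`-th eigenvalue of
`H^(σ) + 1`. -/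
def shiftedEigenvalue (G : MetricGraph V E) (R : Finset V) (n : ℕ) (σ : ℝ) : ℝ :=
  FormPencil.eigenvalue (perturb (sobolev (G := G)) (trace (G := G) R) σ) (embedding (G := G)) n

lemma shiftedEigenvalue_mono [Nonempty E] (R : Finset V) {n : ℕ} (hn : 1 ≤ n) {s t : ℝ}
    (hs : 0 ≤ s) (hst : s ≤ t) : shiftedEigenvalue G R n s ≤ shiftedEigenvalue G R n t :=
  eigenvalue_perturb_mono isDiscrete (trace R) hn hs hst

variable [DecidableEq V]

/-- On every edge, the energy of an eigenfunction dominates the vertex values. -/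
lemma edge_energy_ge {R : Finset V} {σ μ : ℝ} (hσ : 0 ≤ σ) {w : G.FormSpace}
    (hw : w ∈ weakEigenspace G R σ μ) (e : E) {a : ℝ} (ha : a ∈ Icc (0 : ℝ) (G.len e)) :
    μ * (a * ‖vertexValue (G.src e) w‖ ^ 2 + (G.len e - a) * ‖vertexValue (G.tgt e) w‖ ^ 2) ≤
      ‖edgeDeriv e w‖ ^ 2 + μ * ‖edgeEmbedding e w‖ ^ 2 := by
  obtain ⟨u', h1, h2, -⟩ := exists_deriv_of_mem_weakEigenspace hσ hw
  have hl := (G.len_pos e).le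
  have hu := continuousOn_edgeFun w e
  have hu' : ContinuousOn (u' e) (Icc 0 (G.len e)) :=
    IsSobolevTwo.continuousOn_of_eq_integral (G.len_pos e)
      (continuousOn_const.mul hu).integrableOn_Icc (h2 e)
  have hE := fun x hx => IntervalL2.energy_eq (x := x) hu hu' (fun x hx => by
    rw [edgeFun_eq_integral, IntervalL2.integral_congr_ae_Icc (h1 e) hx]) (h2 e) hx
  have hsum : ‖edgeDeriv e w‖ ^ 2 + μ * ‖edgeEmbedding e w‖ ^ 2 =
      G.len e * (‖u' e 0‖ ^ 2 + μ * ‖edgeFun w e 0‖ ^ 2) := by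
    have i1 : IntegrableOn (fun x => ‖u' e x‖ ^ 2) (Icc 0 (G.len e)) :=
      (hu'.norm.pow 2).integrableOn_Icc
    have i2 : IntegrableOn (fun x => μ * ‖edgeFun w e x‖ ^ 2) (Icc 0 (G.len e)) :=
      (continuousOn_const.mul (hu.norm.pow 2)).integrableOn_Icc
    rw [IntervalL2.norm_sq_eq_integral _ (h1 e),
      IntervalL2.norm_sq_eq_integral _ (coeFn_edgeEmbedding w e), ← integral_const_mul,
      ← integral_add i1 i2, setIntegral_congr_fun measurableSet_Icc hE]
    simp [hl]
  have hend := hE (G.len e) (right_mem_Icc.2 hl)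
  rw [hsum]
  rw [edgeFun_len] at hend
  rw [edgeFun_zero] at hend ⊢
  have h3 : 0 ≤ a * ‖u' e 0‖ ^ 2 := mul_nonneg ha.1 (sq_nonneg _)
  have h4 : 0 ≤ (G.len e - a) * ‖u' e (G.len e)‖ ^ 2 :=
    mul_nonneg (sub_nonneg.2 ha.2) (sq_nonneg _)
  -- The constant energy is taken at the source with weight `a` and at the target with weight `G.len
  -- e - a`; the derivative terms at both ends are then discarded.
  have h5 : (G.len e - a) *
      (‖u' e (G.len e)‖ ^ 2 + μ * ‖vertexValue (G.tgt e) w‖ ^ 2) = (G.len e - a) *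
      (‖u' e 0‖ ^ 2 + μ * ‖vertexValue (G.src e) w‖ ^ 2) := by rw [hend]
  linarith

/-- Regrouped by vertices, the weights of the two pieces of each edge add up to the star lengths. At
an isolated vertex both sides vanish, whatever `m` is. -/
lemma star_sum_ge (S : G.StarDecomposition) {R : Finset V} {m : ℝ}
    (hm : ∀ v ∈ R, ¬ G.IsIsolated v → m ≤ S.starLength v) (w : G.FormSpace) :
    m * ‖trace R w‖ ^ 2 ≤ ∑ e, (S.cut e * ‖vertexValue (G.src e) w‖ ^ 2 +
      (G.len e - S.cut e) * ‖vertexValue (G.tgt e) w‖ ^ 2) := by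
  have hsrc : ∑ v, (∑ e with G.src e = v, S.cut e) * ‖vertexValue v w‖ ^ 2 =
      ∑ e, S.cut e * ‖vertexValue (G.src e) w‖ ^ 2 := by
    rw [← Finset.sum_fiberwise Finset.univ G.src]
    refine Finset.sum_congr rfl fun v _ => ?_
    rw [Finset.sum_mul]
    refine Finset.sum_congr rfl fun e he => ?_
    rw [(Finset.mem_filter.1 he).2]
  have htgt : ∑ v, (∑ e with G.tgt e = v, (G.len e - S.cut e)) * ‖vertexValue v w‖ ^ 2 =
      ∑ e, (G.len e - S.cut e) * ‖vertexValue (G.tgt e) w‖ ^ 2 := by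
    rw [← Finset.sum_fiberwise Finset.univ G.tgt]
    refine Finset.sum_congr rfl fun v _ => ?_
    rw [Finset.sum_mul]
    refine Finset.sum_congr rfl fun e he => ?_
    rw [(Finset.mem_filter.1 he).2]
  have hnonneg : ∀ v, 0 ≤ S.starLength v := fun v =>
    add_nonneg (Finset.sum_nonneg fun e _ => (S.cut_mem e).1)
      (Finset.sum_nonneg fun e _ => sub_nonneg.2 (S.cut_mem e).2)
  rw [Finset.sum_add_distrib, ← hsrc, ← htgt, ← Finset.sum_add_distrib, norm_sq_trace,
    Finset.mul_sum]
  refine (Finset.sum_le_sum fun v hv => ?_).trans (Finset.sum_le_sum_of_subset_of_nonneg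
    (f := fun v => S.starLength v * ‖vertexValue v w‖ ^ 2) (Finset.subset_univ R)
    fun v _ _ => mul_nonneg (hnonneg v) (sq_nonneg _)) |>.trans_eq
    (Finset.sum_congr rfl fun v _ => by rw [StarDecomposition.starLength, add_mul])
  by_cases hi : G.IsIsolated v
  · simp [vertexValue_of_isIsolated w hi]
  · exact mul_le_mul_of_nonneg_right (hm v hv hi) (sq_nonneg _)

/-- The trace estimate for eigenfunctions. -/
lemma trace_bound (S : G.StarDecomposition) {R : Finset V} {m : ℝ}
    (hm : ∀ v ∈ R, ¬ G.IsIsolated v → m ≤ S.starLength v) {σ μ M : ℝ} (hσ : 0 ≤ σ)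
    (hM : 0 < M) (hμM : μ ≤ M) {w : G.FormSpace} (hw : w ∈ weakEigenspace G R σ μ) :
    (m + σ / M) * ‖trace R w‖ ^ 2 ≤ 2 * ‖embedding w‖ ^ 2 := by
  have hid := energy_identity hσ hw
  have hstar := star_sum_ge S hm w
  have hT : 0 ≤ σ * ‖trace R w‖ ^ 2 := by positivity
  -- For $\mu<0$ the energy identity leaves only $w=0$. For $\mu=0$ the function is constant on each
  -- edge and $\sigma\sum_R|w(v)|^2=0$. Only for $\mu>0$ can one divide the energy estimate by
  -- $\mu$.
  rcases lt_trichotomy μ 0 with hμ | rfl | hμ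
  · have h1 : ‖embedding w‖ ^ 2 ≤ 0 := by nlinarith [sq_nonneg ‖deriv w‖]
    have h2 : embedding w = 0 := by
      rw [← norm_eq_zero, ← sq_eq_zero_iff]
      exact le_antisymm h1 (sq_nonneg _)
    have h3 : w = 0 := embedding_injective (by rw [h2, map_zero])
    simp [h3]
  · rw [zero_mul] at hid
    have h1 : ‖deriv w‖ ^ 2 = 0 := by nlinarith [sq_nonneg ‖deriv w‖]
    have h2 : σ * ‖trace R w‖ ^ 2 = 0 := by linarith
    have h3 : ∀ e, edgeDeriv e w = 0 := fun e => by
      have : deriv w = 0 := by simpa using h1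
      rw [edgeDeriv, ContinuousLinearMap.comp_apply, this, map_zero]
    have h0 : ∀ e, ∀ x ∈ Icc (0 : ℝ) (G.len e), edgeFun w e x = vertexValue (G.src e) w :=
      fun e x hx => by
        rw [edgeFun, h3, IntervalL2.integral_congr_ae_Icc (Lp.coeFn_zero _ _ _) hx]
        simp
    have h4 : ∀ e, ‖edgeEmbedding e w‖ ^ 2 = S.cut e * ‖vertexValue (G.src e) w‖ ^ 2 +
        (G.len e - S.cut e) * ‖vertexValue (G.tgt e) w‖ ^ 2 := fun e => by
      rw [← edgeFun_len, h0 e _ (right_mem_Icc.2 (G.len_pos e).le),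
        IntervalL2.norm_sq_const (G.len_pos e) (c := vertexValue (G.src e) w)]
      · ring
      · exact (coeFn_edgeEmbedding w e).trans
          ((ae_restrict_iff' measurableSet_Icc).2 (ae_of_all _ (h0 e)))
    rw [← Finset.sum_congr rfl fun e _ => h4 e, ← norm_sq_embedding] at hstar
    have h5 : σ / M * ‖trace R w‖ ^ 2 = 0 := by rw [div_mul_eq_mul_div, h2, zero_div]
    rw [add_mul, h5]
    linarith [sq_nonneg ‖embedding w‖]
  · have h1 : μ * ∑ e, (S.cut e * ‖vertexValue (G.src e) w‖ ^ 2 +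
        (G.len e - S.cut e) * ‖vertexValue (G.tgt e) w‖ ^ 2) ≤
        ‖deriv w‖ ^ 2 + μ * ‖embedding w‖ ^ 2 := by
      rw [norm_sq_deriv, norm_sq_embedding, Finset.mul_sum, Finset.mul_sum,
        ← Finset.sum_add_distrib]
      exact Finset.sum_le_sum fun e _ => edge_energy_ge hσ hw e (S.cut_mem e)
    have h2 : μ * (m * ‖trace R w‖ ^ 2) ≤ 2 * (μ * ‖embedding w‖ ^ 2) - σ * ‖trace R w‖ ^ 2 := by
      have := mul_le_mul_of_nonneg_left hstar hμ.le
      linarith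
    have h3 : μ * (σ / M * ‖trace R w‖ ^ 2) ≤ σ * ‖trace R w‖ ^ 2 := by
      have : μ * (σ / M * ‖trace R w‖ ^ 2) = μ / M * (σ * ‖trace R w‖ ^ 2) := by ring
      rw [this]
      exact mul_le_of_le_one_left hT ((div_le_one hM).2 hμM)
    refine le_of_mul_le_mul_left ?_ hμ
    linarith

/-- The embedding is injective and carries the spectral subspace of the pencil at `Λ + 1` onto the
span of the eigenspaces up to `Λ`. -/
lemma natCast_le_rank_robinEigenspaces {R : Finset V} {σ : ℝ} (hσ : 0 ≤ σ) (n : ℕ) (Λ : ℝ) :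
    (n : Cardinal) ≤ Module.rank ℂ (⨆ μ ∈ Iic Λ, G.robinEigenspace R σ μ : Submodule ℂ G.L2) ↔
      (n : Cardinal) ≤ Module.rank ℂ (spectralSubspace (perturb (sobolev (G := G))
        (trace (G := G) R) σ) (embedding (G := G)) (Λ + 1)) := by
  set f := (L2Space.equivL2 G).toLinearMap ∘ₗ
    (embedding : G.FormSpace →L[ℂ] G.L2Space).toLinearMap with hf
  have hinj : Function.Injective f := (L2Space.equivL2 G).injective.comp embedding_injective
  have hmap : (⨆ μ ∈ Iic Λ, G.robinEigenspace R σ μ : Submodule ℂ G.L2) =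
      (spectralSubspace (perturb (sobolev (G := G)) (trace (G := G) R) σ)
        (embedding (G := G)) (Λ + 1)).map f := by
    rw [spectralSubspace, ← (Equiv.addRight (1 : ℝ)).iSup_comp
      (g := fun κ => ⨆ _ : κ ∈ Iic (Λ + 1), eigenspace (perturb (sobolev (G := G))
        (trace (G := G) R) σ) (embedding (G := G)) κ)]
    simp only [Submodule.map_iSup, Equiv.coe_addRight, mem_Iic, add_le_add_iff_right,
      ← map_weakEigenspace hσ]
    rfl
  have hrank := (Submodule.equivMapOfInjective f hinj (spectralSubspace
    (perturb (sobolev (G := G)) (trace (G := G) R) σ) (embedding (G := G)) (Λ + 1))).lift_rank_eq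
  rw [hmap, ← Cardinal.nat_le_lift_iff, ← hrank, Cardinal.nat_le_lift_iff]

lemma robinEigenvalue_eq [Nonempty E] {R : Finset V} {σ : ℝ} (hσ : 0 ≤ σ) {n : ℕ} (hn : 1 ≤ n) :
    G.robinEigenvalue R σ n = shiftedEigenvalue G R n σ - 1 := by
  have h := (isDiscrete (G := G)).perturb (trace R) hσ
  have hset : {Λ : ℝ | (n : Cardinal) ≤
      Module.rank ℂ (⨆ μ ∈ Iic Λ, G.robinEigenspace R σ μ : Submodule ℂ G.L2)} =
      (fun Λ => Λ - 1) '' {Λ : ℝ | (n : Cardinal) ≤ Module.rank ℂ (spectralSubspace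
        (perturb (sobolev (G := G)) (trace (G := G) R) σ) (embedding (G := G)) Λ)} := by
    ext Λ
    simp only [mem_ofPred_eq, mem_image, natCast_le_rank_robinEigenspaces hσ]
    exact ⟨fun hΛ => ⟨Λ + 1, hΛ, by ring⟩, by rintro ⟨Λ', hΛ', rfl⟩; rwa [sub_add_cancel]⟩
  rw [robinEigenvalue, hset]
  exact ((OrderIso.subRight (1 : ℝ)).map_csInf' (h.exists_le_rank n) (h.bddBelow hn)).symm

lemma robinNeumannGap_eq [Nonempty E] {R : Finset V} {σ : ℝ} (hσ : 0 ≤ σ) {n : ℕ} (hn : 1 ≤ n) :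
    G.robinNeumannGap R n σ = shiftedEigenvalue G R n σ - shiftedEigenvalue G R n 0 := by
  rw [robinNeumannGap, robinEigenvalue_eq hσ hn, robinEigenvalue_eq le_rfl hn,
    sub_sub_sub_cancel_right]

/-- Monotonicity keeps the eigenvalue below `M` on all of $[a,b]$, so the rate $2/(m+t/M)$ is at
most its value at $t=a$. -/
lemma shiftedEigenvalue_le_add [Nonempty E] (S : G.StarDecomposition) {R : Finset V} {m : ℝ}
    (hm0 : 0 < m) (hm : ∀ v ∈ R, ¬ G.IsIsolated v → m ≤ S.starLength v) {n : ℕ} (hn : 1 ≤ n)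
    {a b M : ℝ} (ha : 0 ≤ a) (hab : a ≤ b) (hM : 0 < M) (hbM : shiftedEigenvalue G R n b ≤ M) :
    shiftedEigenvalue G R n b ≤ shiftedEigenvalue G R n a + 2 / (m + a / M) * (b - a) := by
  have hpos : 0 < m + a / M := by positivity
  refine eigenvalue_perturb_le_add isDiscrete hn ha hab (by positivity) fun t ht w hw => ?_
  have hw' : w ∈ weakEigenspace G R t (shiftedEigenvalue G R n t - 1) := by
    rw [weakEigenspace, sub_add_cancel]
    exact hw
  have hμ : shiftedEigenvalue G R n t - 1 ≤ M := by
    linarith [shiftedEigenvalue_mono (G := G) R hn (ha.trans ht.1) ht.2.le]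
  have h1 := trace_bound S hm (ha.trans ht.1) hM hμ hw'
  have h2 : (m + a / M) * ‖trace R w‖ ^ 2 ≤ (m + t / M) * ‖trace R w‖ ^ 2 := by
    have := ht.1
    gcongr
  rw [div_mul_eq_mul_div, le_div_iff₀' hpos]
  exact h2.trans h1

end FormSpace

variable [Nonempty E]

lemma minLength_pos (G : MetricGraph V E) : 0 < G.minLength :=
  (Finset.lt_inf'_iff _).2 fun e _ => G.len_pos e

variable [DecidableEq V]

lemma robinNeumannGap_nonneg [Fintype V] (R : Finset V) {n : ℕ} (hn : 1 ≤ n) {σ : ℝ}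
    (hσ : 0 ≤ σ) : 0 ≤ G.robinNeumannGap R n σ := by
  rw [FormSpace.robinNeumannGap_eq hσ hn]
  exact sub_nonneg.2 (FormSpace.shiftedEigenvalue_mono R hn le_rfl hσ)

/-- A vertex without edges imposes no condition on the star decomposition, because it carries no
part of `L²(Γ)`. -/
theorem robinNeumannGap_lt [Fintype V] (S : G.StarDecomposition) {R : Finset V} {m : ℝ}
    (hm0 : 0 < m) (hm : ∀ v ∈ R, ¬ G.IsIsolated v → m ≤ S.starLength v) {n : ℕ} (hn : 1 ≤ n)
    {σ : ℝ} (hσ : 0 < σ) : G.robinNeumannGap R n σ < 2 * σ / m := by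
  rw [FormSpace.robinNeumannGap_eq hσ.le hn]
  set N := FormSpace.shiftedEigenvalue G R n
  set M := |N σ| + 1
  have hM : 0 < M := by positivity
  have hσM : N σ ≤ M := (le_abs_self _).trans (lt_add_one _).le
  have hmid : N (σ / 2) ≤ N σ :=
    FormSpace.shiftedEigenvalue_mono R hn (by positivity) (by linarith)
  -- On $[0,\sigma/2]$ the rate is only bounded by $2/m$; on $[\sigma/2,\sigma]$ it is at most
  -- $2/(m+\sigma/(2M))<2/m$, which gives strictness.
  have h1 := FormSpace.shiftedEigenvalue_le_add S hm0 hm hn le_rfl (half_pos hσ).le hM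
    (hmid.trans hσM)
  have h2 := FormSpace.shiftedEigenvalue_le_add S hm0 hm hn (half_pos hσ).le
    (half_le_self hσ.le) hM hσM
  have h3 : 2 / (m + σ / 2 / M) < 2 / m :=
    div_lt_div_of_pos_left two_pos hm0 (lt_add_of_pos_right _ (by positivity))
  have h4 : 2 / (m + σ / 2 / M) * (σ - σ / 2) < 2 / m * (σ - σ / 2) :=
    mul_lt_mul_of_pos_right h3 (by linarith)
  have h5 : 2 * σ / m = 2 / m * (σ - σ / 2) + 2 / m * (σ / 2 - 0) := by ring
  rw [zero_div, add_zero] at h1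
  linarith

/-- The star decomposition that cuts every edge in its middle. -/
def midpointDecomposition (G : MetricGraph V E) : G.StarDecomposition where
  cut e := G.len e / 2
  cut_mem e := ⟨(half_pos (G.len_pos e)).le, half_le_self (G.len_pos e).le⟩

/-- The star of such a vertex contains at least half an edge. -/
lemma le_starLength_midpointDecomposition {v : V} (hv : ¬ G.IsIsolated v) :
    G.minLength / 2 ≤ G.midpointDecomposition.starLength v := by
  have hmin : ∀ e, G.minLength / 2 ≤ G.len e / 2 := fun e =>
    div_le_div_of_nonneg_right (Finset.inf'_le _ (Finset.mem_univ e)) two_pos.le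
  have hcut : ∀ e, 0 ≤ G.midpointDecomposition.cut e := fun e =>
    (G.midpointDecomposition.cut_mem e).1
  have hcut' : ∀ e, 0 ≤ G.len e - G.midpointDecomposition.cut e := fun e =>
    sub_nonneg.2 (G.midpointDecomposition.cut_mem e).2
  obtain ⟨e, he⟩ : ∃ e, G.src e = v ∨ G.tgt e = v := by
    by_contra! h
    exact hv h
  rw [StarDecomposition.starLength]
  rcases he with he | he
  · have := Finset.single_le_sum (s := {e | G.src e = v}) (f := G.midpointDecomposition.cut)
      (fun e _ => hcut e)
      (Finset.mem_filter.2 ⟨Finset.mem_univ e, he⟩)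
    exact (hmin e).trans (this.trans (le_add_of_nonneg_right
      (Finset.sum_nonneg fun e _ => hcut' e)))
  · have := Finset.single_le_sum (s := {e | G.tgt e = v})
      (f := fun e => G.len e - G.midpointDecomposition.cut e)
      (fun e _ => hcut' e) (Finset.mem_filter.2 ⟨Finset.mem_univ e, he⟩)
    refine (hmin e).trans ((le_of_eq ?_).trans (this.trans (le_add_of_nonneg_left
      (Finset.sum_nonneg fun e _ => hcut e))))
    exact (sub_half _).symm

end MetricGraph

end

theorem theorem1p5 {V E : Type*} [Finite V] [DecidableEq V] [Fintype E] [Nonempty E]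
    (G : MetricGraph V E) (R : Finset V) (n : ℕ) (hn : 1 ≤ n) (σ : ℝ) (hσ : 0 < σ) :
    0 ≤ G.robinNeumannGap R n σ ∧
    (∀ (S : G.StarDecomposition) (hR : R.Nonempty), 0 < R.inf' hR S.starLength →
      G.robinNeumannGap R n σ < 2 * σ / R.inf' hR S.starLength) ∧
    G.robinNeumannGap R n σ < 4 * σ / G.minLength := by
  have := Fintype.ofFinite V
  refine ⟨MetricGraph.robinNeumannGap_nonneg R hn hσ.le, fun S hR hS =>
    MetricGraph.robinNeumannGap_lt S hS (fun v hv _ => Finset.inf'_le _ hv) hn hσ, ?_⟩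
  -- With $m=\ell_{\min}/2$ the bound $2\sigma/m$ is $4\sigma/\ell_{\min}$. Isolated vertices of
  -- `R`, whose stars have length 0, are harmless because the condition on `m` skips them.
  have h := MetricGraph.robinNeumannGap_lt G.midpointDecomposition (R := R)
    (half_pos G.minLength_pos) (fun v _ hv => MetricGraph.le_starLength_midpointDecomposition hv)
    hn hσ
  rwa [show 2 * σ / (G.minLength / 2) = 4 * σ / G.minLength by ring] at h
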